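/- Work in the language of first-order arithmetic with the connectives $\land,\lor,\to,\bot$ and the quantifiers $\forall,\exists$, with equality and with a function symbol for every primitive recursive function; $\neg\varphi$ abbreviates $\varphi\to\bot$. Let $\mathbf{HA}$ be Heyting arithmetic, that is, the theory over intuitionistic first-order logic with equality whose axioms are the successor axioms, the defining equations of all primitive recursive functions, and induction for all formulas. Let $\Sigma_0=\Pi_0$ be the set of quantifier-free formulas, and for $k\ge 0$ let $\Sigma_{k+1}$ be the set of formulas $\exists x_1\cdots\exists x_n\,\varphi$ with $n\ge 1$ and $\varphi\in\Pi_k$, and $\Pi_{k+1}$ the set of formulas $\forall x_1\cdots\forall x_n\,\varphi$ with $n\ge 1$ and $\varphi\in\Sigma_k$; let $\Sigma_{-1}=\emptyset$. Formulas may have free variables. Consider the following principles, given by their instances: - $\Sigma_m\text{-}\mathbf{DNE}$: $\neg\neg\varphi\to\varphi$, for $\varphi\in\Sigma_m$; - $\Delta_k\text{-}\mathbf{DML}$: $(\varphi\leftrightarrow\varphi')\land(\psi\leftrightarrow\psi')\to\bigl(\neg(\varphi\land\psi)\to\neg\varphi\lor\neg\psi\bigr)$, for $\varphi,\psi\in\Sigma_k$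 and $\varphi',\psi'\in\Pi_k$; - $\neg\Delta_k\text{-}\mathbf{DML}$: $(\varphi\leftrightarrow\varphi')\land(\psi\leftrightarrow\psi')\to\bigl(\neg(\neg\varphi\land\neg\psi)\to\neg\neg\varphi\lor\neg\neg\psi\bigr)$, for $\varphi,\psi\in\Sigma_k$ and $\varphi',\psi'\in\Pi_k$. Adding a principle to a theory means adding the universal closures of all its instances as axioms. Then for every natural number $k\ge 0$, $$\mathbf{HA}+\Delta_k\text{-}\mathbf{DML}+\Sigma_{k-1}\text{-}\mathbf{DNE}\;\vdash\;\neg\Delta_k\text{-}\mathbf{DML},$$ that is, the theory on the left proves every instance of $\neg\Delta_k\text{-}\mathbf{DML}$. -/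

import Mathlib

namespace HeytingArith

/-- Codes of primitive recursive functions; they serve as the function symbols of the language,
`PRCode n` being the set of `n`-ary function symbols.
`prec f g` is the function `h` with `h (0, x) = f x` and `h (y + 1, x) = g (y, h (y, x), x)`. -/
inductive PRCode : ℕ → Type
  | zero : PRCode 0
  | succ : PRCode 1
  | proj {n : ℕ} (i : Fin n) : PRCode n
  | comp {m n : ℕ} (f : PRCode n) (g : Fin n → PRCode m) : PRCode m
  | prec {n : ℕ} (f : PRCode n) (g : PRCode (n + 2)) : PRCode (n + 1)

/-- The language of first-order arithmetic: a function symbol for every primitive recursive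
function, and equality as the only predicate symbol. -/
def arith : FirstOrder.Language := ⟨PRCode, fun _ => Empty⟩

/-- Terms, with variables named by natural numbers (de Bruijn indices). -/
abbrev Tm : Type := arith.Term ℕ

/-- The variable with index `i`. -/
def v (i : ℕ) : Tm := FirstOrder.Language.Term.var i

/-- The application of a function symbol to terms. -/
def app {n : ℕ} (f : PRCode n) (ts : Fin n → Tm) : Tm :=
  FirstOrder.Language.Term.func (L := arith) f ts

/-- The constant `0`. -/
def zeroTm : Tm := app PRCode.zero Fin.elim0

/-- The successor of a term. -/
def succTm (t : Tm) : Tm := app PRCode.succ (fun _ => t)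

/-- First-order formulas in de Bruijn style: in `all φ` and `ex φ` the quantifier binds the
variable `0` of `φ`, and the variable `i + 1` of `φ` is the variable `i` outside. -/
inductive Formula : Type
  | falsum : Formula
  | eq (t s : Tm) : Formula
  | and (φ ψ : Formula) : Formula
  | or (φ ψ : Formula) : Formula
  | imp (φ ψ : Formula) : Formula
  | all (φ : Formula) : Formula
  | ex (φ : Formula) : Formula

namespace Formula

/-- Negation, as implication of absurdity. -/
def neg (φ : Formula) : Formula := imp φ falsum

/-- The biconditional. -/
def iff (φ ψ : Formula) : Formula := and (imp φ ψ) (imp ψ φ)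

end Formula

/-- The substitution `σ` moved below a quantifier. -/
def liftSubst (σ : ℕ → Tm) : ℕ → Tm
  | 0 => v 0
  | i + 1 => (σ i).relabel Nat.succ

/-- The substitution that replaces the variable `0` by `t` and lowers all other variables. -/
def instSubst (t : Tm) : ℕ → Tm
  | 0 => t
  | i + 1 => v i

/-- The substitution that replaces the variable `0` by its successor. -/
def succSubst : ℕ → Tm
  | 0 => succTm (v 0)
  | i + 1 => v (i + 1)

namespace Formula

/-- Simultaneous capture-avoiding substitution. -/
def subst : Formula → (ℕ → Tm) → Formula
  | falsum, _ => falsum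
  | eq t s, σ => eq (t.subst σ) (s.subst σ)
  | and φ ψ, σ => and (φ.subst σ) (ψ.subst σ)
  | or φ ψ, σ => or (φ.subst σ) (ψ.subst σ)
  | imp φ ψ, σ => imp (φ.subst σ) (ψ.subst σ)
  | all φ, σ => all (φ.subst (liftSubst σ))
  | ex φ, σ => ex (φ.subst (liftSubst σ))

/-- The formula with every free variable raised by one. -/
def shift (φ : Formula) : Formula := φ.subst (fun i => v (i + 1))

/-- The instance `φ(t)` of the body `φ` of a quantified formula. -/
def inst (φ : Formula) (t : Tm) : Formula := φ.subst (instSubst t)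

/-- The least `n` such that every free variable of `φ` is less than `n`. -/
def fvBound : Formula → ℕ
  | falsum => 0
  | eq t s => max (t.varFinset.sup Nat.succ) (s.varFinset.sup Nat.succ)
  | and φ ψ => max φ.fvBound ψ.fvBound
  | or φ ψ => max φ.fvBound ψ.fvBound
  | imp φ ψ => max φ.fvBound ψ.fvBound
  | all φ => φ.fvBound - 1
  | ex φ => φ.fvBound - 1

/-- The universal closure of a formula. -/
def univClosure (φ : Formula) : Formula := all^[φ.fvBound] φ

/-- Quantifier-free formulas. -/
def QuantifierFree : Formula → Prop
  | falsum => True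
  | eq _ _ => True
  | and φ ψ => φ.QuantifierFree ∧ ψ.QuantifierFree
  | or φ ψ => φ.QuantifierFree ∧ ψ.QuantifierFree
  | imp φ ψ => φ.QuantifierFree ∧ ψ.QuantifierFree
  | all _ => False
  | ex _ => False

end Formula

open Formula

/-- Natural deduction for intuitionistic first-order logic with equality. `Deriv T Γ φ` says that
`φ` is derivable from the axioms in `T` (a set of sentences) and the open assumptions in `Γ`. -/
inductive Deriv (T : Set Formula) : List Formula → Formula → Prop
  | ofTheory {Γ : List Formula} {φ : Formula} : φ ∈ T → Deriv T Γ φ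
  | hyp {Γ : List Formula} {φ : Formula} : φ ∈ Γ → Deriv T Γ φ
  | falsumE {Γ : List Formula} {φ : Formula} : Deriv T Γ falsum → Deriv T Γ φ
  | andI {Γ : List Formula} {φ ψ : Formula} : Deriv T Γ φ → Deriv T Γ ψ → Deriv T Γ (and φ ψ)
  | andE₁ {Γ : List Formula} {φ ψ : Formula} : Deriv T Γ (and φ ψ) → Deriv T Γ φ
  | andE₂ {Γ : List Formula} {φ ψ : Formula} : Deriv T Γ (and φ ψ) → Deriv T Γ ψ
  | orI₁ {Γ : List Formula} {φ ψ : Formula} : Deriv T Γ φ → Deriv T Γ (or φ ψ)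
  | orI₂ {Γ : List Formula} {φ ψ : Formula} : Deriv T Γ ψ → Deriv T Γ (or φ ψ)
  | orE {Γ : List Formula} {φ ψ χ : Formula} :
      Deriv T Γ (or φ ψ) → Deriv T (φ :: Γ) χ → Deriv T (ψ :: Γ) χ → Deriv T Γ χ
  | impI {Γ : List Formula} {φ ψ : Formula} : Deriv T (φ :: Γ) ψ → Deriv T Γ (imp φ ψ)
  | impE {Γ : List Formula} {φ ψ : Formula} :
      Deriv T Γ (imp φ ψ) → Deriv T Γ φ → Deriv T Γ ψ
  | allI {Γ : List Formula} {φ : Formula} : Deriv T (Γ.map shift) φ → Deriv T Γ (all φ)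
  | allE {Γ : List Formula} {φ : Formula} (t : Tm) : Deriv T Γ (all φ) → Deriv T Γ (φ.inst t)
  | exI {Γ : List Formula} {φ : Formula} (t : Tm) : Deriv T Γ (φ.inst t) → Deriv T Γ (ex φ)
  | exE {Γ : List Formula} {φ ψ : Formula} :
      Deriv T Γ (ex φ) → Deriv T (φ :: Γ.map shift) ψ.shift → Deriv T Γ ψ
  | eqI {Γ : List Formula} (t : Tm) : Deriv T Γ (eq t t)
  | eqE {Γ : List Formula} {t s : Tm} (φ : Formula) :
      Deriv T Γ (eq t s) → Deriv T Γ (φ.inst t) → Deriv T Γ (φ.inst s)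

/-- The arithmetical axioms, with free variables: the successor axioms, the defining equations of
all primitive recursive functions, and induction for all formulas. -/
inductive IsArithAx : Formula → Prop
  | succNeZero : IsArithAx (neg (eq (succTm (v 0)) zeroTm))
  | succInj : IsArithAx (imp (eq (succTm (v 0)) (succTm (v 1))) (eq (v 0) (v 1)))
  | projEq {n : ℕ} (i : Fin n) : IsArithAx (eq (app (PRCode.proj i) (fun j => v j)) (v i))
  | compEq {m n : ℕ} (f : PRCode n) (g : Fin n → PRCode m) :
      IsArithAx (eq (app (PRCode.comp f g) (fun j => v j))
        (app f (fun i => app (g i) (fun j => v j))))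
  | precZero {n : ℕ} (f : PRCode n) (g : PRCode (n + 2)) :
      IsArithAx (eq (app (PRCode.prec f g) (Fin.cons zeroTm (fun j : Fin n => v j)))
        (app f (fun j => v j)))
  | precSucc {n : ℕ} (f : PRCode n) (g : PRCode (n + 2)) :
      IsArithAx (eq
        (app (PRCode.prec f g) (Fin.cons (succTm (v 0)) (fun j : Fin n => v ((j : ℕ) + 1))))
        (app g (Fin.cons (v 0)
          (Fin.cons (app (PRCode.prec f g) (Fin.cons (v 0) (fun j : Fin n => v ((j : ℕ) + 1))))
            (fun j : Fin n => v ((j : ℕ) + 1))))))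
  | induction (φ : Formula) :
      IsArithAx (imp (φ.inst zeroTm) (imp (all (imp φ (φ.subst succSubst))) (all φ)))

/-- Heyting arithmetic, given by its axioms. -/
def HA : Set Formula := univClosure '' {φ | IsArithAx φ}

/-- `T + P`: the theory `T` with the universal closures of all instances of the principle `P`
(given as the set of its instances) as additional axioms. -/
def addPrinciple (T P : Set Formula) : Set Formula := T ∪ univClosure '' P

/-- `T ⊢ P`: the theory `T` proves every instance of the principle `P`. -/
def Proves (T P : Set Formula) : Prop := ∀ φ ∈ P, Deriv T [] φ

mutual

/-- `Σ_k` for natural numbers `k`. -/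
def sigmaNat : ℕ → Set Formula
  | 0 => {φ | φ.QuantifierFree}
  | k + 1 => {φ | ∃ n ≥ 1, ∃ ψ ∈ piNat k, φ = ex^[n] ψ}

/-- `Π_k` for natural numbers `k`. -/
def piNat : ℕ → Set Formula
  | 0 => {φ | φ.QuantifierFree}
  | k + 1 => {φ | ∃ n ≥ 1, ∃ ψ ∈ sigmaNat k, φ = all^[n] ψ}

end

/-- `Σ_m` for integers `m`; it is empty for negative `m`. -/
def sigmaClass : ℤ → Set Formula
  | Int.ofNat k => sigmaNat k
  | Int.negSucc _ => ∅

/-- `Π_m` for integers `m`; it is empty for negative `m`. -/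
def piClass : ℤ → Set Formula
  | Int.ofNat k => piNat k
  | Int.negSucc _ => ∅

/-- The double negation elimination for formulas in `C`. -/
def DNE (C : Set Formula) : Set Formula := {χ | ∃ φ ∈ C, χ = imp (neg (neg φ)) φ}

/-- De Morgan's law for `φ` and `ψ`. -/
def deMorgan (φ ψ : Formula) : Formula := imp (neg (and φ ψ)) (or (neg φ) (neg ψ))

/-- De Morgan's law for `Δ_k` formulas. -/
def DMLDelta (k : ℤ) : Set Formula :=
  {χ | ∃ φ ∈ sigmaClass k, ∃ ψ ∈ sigmaClass k, ∃ φ' ∈ piClass k, ∃ ψ' ∈ piClass k,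
    χ = imp (and (iff φ φ') (iff ψ ψ')) (deMorgan φ ψ)}

/-- De Morgan's law for negated `Δ_k` formulas. -/
def DMLNegDelta (k : ℤ) : Set Formula :=
  {χ | ∃ φ ∈ sigmaClass k, ∃ ψ ∈ sigmaClass k, ∃ φ' ∈ piClass k, ∃ ψ' ∈ piClass k,
    χ = imp (and (iff φ φ') (iff ψ ψ')) (deMorgan (neg φ) (neg ψ))}

end HeytingArith

-- For `k = 0` the negations of quantifier-free formulas are quantifier-free, so the claim is an
-- instance of the axiom. In the step the level is `k + 1`, with double negation elimination for
-- `Σ_k`.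
--
-- Contract quantifiers by pairing, so that `φ` is `∃x A` and `ψ` is `∃x C` with `A`, `C` in `Π_k`.
-- Let `P` say that a least witness of either formula exists and satisfies `A`, and `Q` that it
-- satisfies `C` but not `A`. Both are `Σ_{k+1}` and they exclude each other. De Morgan's law for
-- `Δ_{k+1}` gives excluded middle for `Π_k` (`HasDML.em`), so the search for a least witness can be
-- carried out intuitionistically, and `φ ∨ ψ` implies `P ∨ Q` (`Separation.deriv_or`).
--
-- Now assume `¬(¬φ ∧ ¬ψ)`, and let `X`, `Z` be `Π_{k+1}` forms of `¬Q`, `¬P`. Classically `X`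
-- forces `φ`, so `X` yields `¬¬φ`. As `φ` is equivalent to a `Π_{k+1}` formula, it is stable, so
-- `φ` holds, hence `P ∨ Q`, hence `P`. Thus `P ↔ X`, and likewise `Q ↔ Z`: under the assumptions
-- `P` and `Q` are `Δ_{k+1}`. De Morgan's law gives `¬P ∨ ¬Q`. From `¬P` and `¬ψ` follows `¬φ`, a
-- contradiction, so `¬P` gives `¬¬ψ`; symmetrically `¬Q` gives `¬¬φ` (`HasDML.neg_deMorgan`).
--
-- The classical facts used on the way (normal forms, collection, least numbers) are not derived
-- formally. A formula provably equivalent to its negative translation is derivable as soon as it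
-- holds in all models of classical arithmetic (`Good.deriv`). This rests on a completeness theorem
-- for negative formulas, and `Σ_k` double negation elimination makes all `Σ_k` and `Π_{k+1}`
-- formulas eligible.

namespace HeytingArith

open Formula FirstOrder.Language

/-- The sequence `a, ρ 0, ρ 1, …`. -/
def scons {α : Type*} (a : α) (ρ : ℕ → α) : ℕ → α
  | 0 => a
  | i + 1 => ρ i

@[simp] theorem scons_zero {α : Type*} (a : α) (ρ : ℕ → α) : scons a ρ 0 = a := rfl

@[simp] theorem scons_succ {α : Type*} (a : α) (ρ : ℕ → α) (i : ℕ) :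
    scons a ρ (i + 1) = ρ i := rfl

@[simp] theorem scons_one {α : Type*} (a : α) (ρ : ℕ → α) : scons a ρ 1 = ρ 0 := rfl

theorem scons_eta {α : Type*} (ρ : ℕ → α) : scons (ρ 0) (fun i => ρ (i + 1)) = ρ := by
  funext i; cases i <;> rfl

/-! ### Substitution -/

theorem v_subst (i : ℕ) (σ : ℕ → Tm) : (v i).subst σ = σ i := rfl

theorem tm_subst_subst (t : Tm) (σ τ : ℕ → Tm) :
    (t.subst σ).subst τ = t.subst (fun i => (σ i).subst τ) := by
  induction t with
  | var i => rfl
  | func f ts ih => simp only [Term.subst]; congr 1; funext i; exact ih i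

theorem tm_subst_v (t : Tm) : t.subst v = t := by
  induction t with
  | var i => rfl
  | func f ts ih => simp only [Term.subst]; congr 1; funext i; exact ih i

theorem tm_relabel_eq (t : Tm) (g : ℕ → ℕ) : t.relabel g = t.subst (fun i => v (g i)) := by
  induction t with
  | var i => rfl
  | func f ts ih => simp only [Term.subst, Term.relabel]; congr 1; funext i; exact ih i

theorem tm_subst_congr (t : Tm) {σ τ : ℕ → Tm}
    (h : ∀ i < t.varFinset.sup Nat.succ, σ i = τ i) : t.subst σ = t.subst τ := by
  induction t with
  | var i => exact h i (by simp [Term.varFinset])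
  | func f ts ih =>
    simp only [Term.subst]; congr 1; funext i
    refine ih i (fun j hj => h j (hj.trans_le ?_))
    apply Finset.sup_mono
    intro x hx
    simp only [Term.varFinset, Finset.mem_biUnion]
    exact ⟨i, Finset.mem_univ _, hx⟩

theorem lift_subst_lift (σ τ : ℕ → Tm) :
    (fun i => (liftSubst σ i).subst (liftSubst τ)) = liftSubst (fun i => (σ i).subst τ) := by
  funext i
  cases i with
  | zero => rfl
  | succ i => simp only [liftSubst, tm_relabel_eq, tm_subst_subst, v_subst, Nat.succ_eq_add_one]

theorem lift_v : liftSubst v = v := by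
  funext i; cases i <;> rfl

theorem subst_subst (φ : Formula) (σ τ : ℕ → Tm) :
    (φ.subst σ).subst τ = φ.subst (fun i => (σ i).subst τ) := by
  induction φ generalizing σ τ with
  | falsum => rfl
  | eq t s => simp [Formula.subst, tm_subst_subst]
  | and φ ψ h₁ h₂ => simp [Formula.subst, h₁, h₂]
  | or φ ψ h₁ h₂ => simp [Formula.subst, h₁, h₂]
  | imp φ ψ h₁ h₂ => simp [Formula.subst, h₁, h₂]
  | all φ h => simp only [Formula.subst, h, lift_subst_lift]
  | ex φ h => simp only [Formula.subst, h, lift_subst_lift]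

theorem subst_v (φ : Formula) : φ.subst v = φ := by
  induction φ with
  | falsum => rfl
  | eq t s => simp [Formula.subst, tm_subst_v]
  | and φ ψ h₁ h₂ => simp [Formula.subst, h₁, h₂]
  | or φ ψ h₁ h₂ => simp [Formula.subst, h₁, h₂]
  | imp φ ψ h₁ h₂ => simp [Formula.subst, h₁, h₂]
  | all φ h => simp only [Formula.subst, lift_v, h]
  | ex φ h => simp only [Formula.subst, lift_v, h]

theorem subst_congr (φ : Formula) {σ τ : ℕ → Tm} (h : ∀ i < φ.fvBound, σ i = τ i) :
    φ.subst σ = φ.subst τ := by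
  have hl : ∀ {n : ℕ} {σ τ : ℕ → Tm}, (∀ i < n - 1, σ i = τ i) →
      ∀ i < n, liftSubst σ i = liftSubst τ i := by
    intro n σ τ h i hi
    cases i with
    | zero => rfl
    | succ i => simp only [liftSubst]; rw [h i (by omega)]
  induction φ generalizing σ τ with
  | falsum => rfl
  | eq t s =>
    simp only [Formula.subst]
    rw [tm_subst_congr t fun i hi => h i (lt_max_of_lt_left hi),
      tm_subst_congr s fun i hi => h i (lt_max_of_lt_right hi)]
  | and φ ψ h₁ h₂ =>
    simp only [Formula.subst]
    rw [h₁ fun i hi => h i (lt_max_of_lt_left hi), h₂ fun i hi => h i (lt_max_of_lt_right hi)]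
  | or φ ψ h₁ h₂ =>
    simp only [Formula.subst]
    rw [h₁ fun i hi => h i (lt_max_of_lt_left hi), h₂ fun i hi => h i (lt_max_of_lt_right hi)]
  | imp φ ψ h₁ h₂ =>
    simp only [Formula.subst]
    rw [h₁ fun i hi => h i (lt_max_of_lt_left hi), h₂ fun i hi => h i (lt_max_of_lt_right hi)]
  | all φ ih => simp only [Formula.subst]; rw [ih (hl h)]
  | ex φ ih => simp only [Formula.subst]; rw [ih (hl h)]

theorem inst_subst_lift (φ : Formula) (σ : ℕ → Tm) (t : Tm) :
    (φ.subst (liftSubst σ)).inst t = φ.subst (scons t σ) := by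
  rw [Formula.inst, subst_subst]
  congr 1; funext i
  cases i with
  | zero => rfl
  | succ i =>
    simp only [liftSubst, tm_relabel_eq, tm_subst_subst, scons_succ]
    exact tm_subst_v _

theorem instSubst_eq (t : Tm) : instSubst t = scons t v := by
  funext i; cases i <;> rfl

theorem shift_inst (φ : Formula) (t : Tm) : φ.shift.inst t = φ := by
  rw [Formula.inst, Formula.shift, subst_subst]
  exact subst_v φ

theorem scons_v_zero : scons (v 0) (fun i => v (i + 1)) = v := scons_eta v

/-! ### Derivations -/

theorem Deriv.weaken {T : Set Formula} {Γ Δ : List Formula} {φ : Formula} (h : Deriv T Γ φ)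
    (hs : Γ ⊆ Δ) : Deriv T Δ φ := by
  induction h generalizing Δ with
  | ofTheory h => exact .ofTheory h
  | hyp h => exact .hyp (hs h)
  | falsumE _ ih => exact .falsumE (ih hs)
  | andI _ _ h₁ h₂ => exact .andI (h₁ hs) (h₂ hs)
  | andE₁ _ ih => exact .andE₁ (ih hs)
  | andE₂ _ ih => exact .andE₂ (ih hs)
  | orI₁ _ ih => exact .orI₁ (ih hs)
  | orI₂ _ ih => exact .orI₂ (ih hs)
  | orE _ _ _ h₁ h₂ h₃ =>
    exact .orE (h₁ hs) (h₂ (List.cons_subset_cons _ hs)) (h₃ (List.cons_subset_cons _ hs))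
  | impI _ ih => exact .impI (ih (List.cons_subset_cons _ hs))
  | impE _ _ h₁ h₂ => exact .impE (h₁ hs) (h₂ hs)
  | allI _ ih => exact .allI (ih (List.map_subset _ hs))
  | allE t _ ih => exact .allE t (ih hs)
  | exI t _ ih => exact .exI t (ih hs)
  | exE _ _ h₁ h₂ => exact .exE (h₁ hs) (h₂ (List.cons_subset_cons _ (List.map_subset _ hs)))
  | eqI t => exact .eqI t
  | eqE φ _ _ h₁ h₂ => exact .eqE φ (h₁ hs) (h₂ hs)

theorem Deriv.lift {T : Set Formula} {Γ : List Formula} {φ : Formula} (h : Deriv T [] φ) :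
    Deriv T Γ φ := h.weaken (List.nil_subset _)

/-- Apply a provable implication. -/
theorem Deriv.mp {T : Set Formula} {Γ : List Formula} {φ ψ : Formula}
    (h : Deriv T [] (imp φ ψ)) (h' : Deriv T Γ φ) : Deriv T Γ ψ := .impE h.lift h'

theorem Deriv.hyp₀ {T : Set Formula} {Γ : List Formula} {φ : Formula} : Deriv T (φ :: Γ) φ :=
  .hyp (by simp)

theorem Deriv.hyp₁ {T : Set Formula} {Γ : List Formula} {φ ψ : Formula} :
    Deriv T (ψ :: φ :: Γ) φ := .hyp (by simp)

theorem Deriv.hyp₂ {T : Set Formula} {Γ : List Formula} {φ ψ χ : Formula} :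
    Deriv T (χ :: ψ :: φ :: Γ) φ := .hyp (by simp)

theorem Deriv.hyp₃ {T : Set Formula} {Γ : List Formula} {φ ψ χ ξ : Formula} :
    Deriv T (ξ :: χ :: ψ :: φ :: Γ) φ := .hyp (by simp)

theorem Deriv.cut {T : Set Formula} {Γ : List Formula} {φ ψ : Formula}
    (h : Deriv T Γ φ) (h' : Deriv T (φ :: Γ) ψ) : Deriv T Γ ψ := .impE (.impI h') h

theorem Deriv.cut_single {T : Set Formula} {Γ : List Formula} {φ ψ : Formula}
    (h : Deriv T Γ φ) (h' : Deriv T [φ] ψ) : Deriv T Γ ψ := .mp (.impI h') h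

theorem Deriv.allE_iterate {T : Set Formula} (n : ℕ) {Γ : List Formula} {φ : Formula}
    (h : Deriv T Γ (all^[n] φ)) (σ : ℕ → Tm) :
    Deriv T Γ (φ.subst (fun i => if i < n then σ i else v (i - n))) := by
  induction n generalizing φ σ with
  | zero => simpa using (subst_v φ).symm ▸ h
  | succ n ih =>
    -- The iterate unfolds at the inside: `ih` removes the `n` outer quantifiers, and the innermost
    -- one, which binds variable `0`, receives `σ 0`.
    have h₁ := (ih (φ := all φ) h (fun i => σ (i + 1))).allE (σ 0)
    rw [inst_subst_lift] at h₁
    convert h₁ using 2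
    funext i
    cases i <;> simp

theorem Deriv.of_univClosure {T : Set Formula} {Γ : List Formula} {φ : Formula}
    (h : Deriv T Γ φ.univClosure) (σ : ℕ → Tm) : Deriv T Γ (φ.subst σ) := by
  -- Instantiating the closure lowers the variables beyond `fvBound` instead of applying `σ` to
  -- them; they do not occur in `φ`.
  rw [subst_congr φ (τ := fun i => if i < φ.fvBound then σ i else v (i - φ.fvBound))
    (fun i hi => by simp [hi])]
  exact Deriv.allE_iterate _ h σ

/-- Without open assumptions generalization is unrestricted, so the universal closure is derivable
and can be instantiated. -/
theorem Deriv.subst {T : Set Formula} {φ : Formula} (h : Deriv T [] φ) (σ : ℕ → Tm) :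
    Deriv T [] (φ.subst σ) := by
  refine Deriv.of_univClosure ?_ σ
  rw [Formula.univClosure]
  generalize φ.fvBound = n
  induction n generalizing φ with
  | zero => exact h
  | succ n ih => exact ih (φ := all φ) (.allI h)

theorem Deriv.of_closure_mem {T : Set Formula} {φ : Formula} (h : φ.univClosure ∈ T) :
    Deriv T [] φ := by
  simpa [subst_v] using Deriv.of_univClosure (.ofTheory h) v

/-- Instantiation of a universal formula in which the bound variable is only renamed. -/
theorem Deriv.allE_shift {T : Set Formula} {Γ : List Formula} {φ : Formula}
    (h : Deriv T Γ (all φ).shift) : Deriv T Γ φ := by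
  have := Deriv.allE (v 0) (show Deriv T Γ (all (φ.subst _)) from h)
  rwa [inst_subst_lift, scons_v_zero, subst_v] at this

theorem Deriv.exI_shift {T : Set Formula} {Γ : List Formula} {φ : Formula}
    (h : Deriv T Γ φ) : Deriv T Γ (ex φ).shift := by
  refine Deriv.exI (φ := φ.subst _) (v 0) ?_
  rwa [inst_subst_lift, scons_v_zero, subst_v]

theorem Deriv.iff_refl {T : Set Formula} (φ : Formula) : Deriv T [] (iff φ φ) :=
  .andI (.impI .hyp₀) (.impI .hyp₀)

theorem Deriv.iff_symm {T : Set Formula} {Γ : List Formula} {φ ψ : Formula}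
    (h : Deriv T Γ (iff φ ψ)) : Deriv T Γ (iff ψ φ) := .andI (.andE₂ h) (.andE₁ h)

theorem Deriv.iff_mp {T : Set Formula} {Γ : List Formula} {φ ψ : Formula}
    (h : Deriv T [] (iff φ ψ)) (h' : Deriv T Γ φ) : Deriv T Γ ψ := .impE (.andE₁ h.lift) h'

theorem Deriv.iff_mpr {T : Set Formula} {Γ : List Formula} {φ ψ : Formula}
    (h : Deriv T [] (iff φ ψ)) (h' : Deriv T Γ ψ) : Deriv T Γ φ := .impE (.andE₂ h.lift) h'

theorem Deriv.iff_of {T : Set Formula} {φ ψ : Formula} (h : Deriv T [φ] ψ) (h' : Deriv T [ψ] φ) :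
    Deriv T [] (iff φ ψ) := .andI (.impI h) (.impI h')

theorem Deriv.iff_trans {T : Set Formula} {φ ψ χ : Formula} (h : Deriv T [] (iff φ ψ))
    (h' : Deriv T [] (iff ψ χ)) : Deriv T [] (iff φ χ) :=
  .iff_of (h'.iff_mp (h.iff_mp .hyp₀)) (h.iff_mpr (h'.iff_mpr .hyp₀))

theorem Deriv.iff_all {T : Set Formula} {φ ψ : Formula} (h : Deriv T [] (iff φ ψ)) :
    Deriv T [] (iff (all φ) (all ψ)) :=
  .iff_of (.allI (h.iff_mp (.allE_shift .hyp₀))) (.allI (h.iff_mpr (.allE_shift .hyp₀)))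

theorem Deriv.iff_ex {T : Set Formula} {φ ψ : Formula} (h : Deriv T [] (iff φ ψ)) :
    Deriv T [] (iff (ex φ) (ex ψ)) :=
  .iff_of (.exE .hyp₀ (.exI_shift (h.iff_mp .hyp₀))) (.exE .hyp₀ (.exI_shift (h.iff_mpr .hyp₀)))

theorem Deriv.iff_dummy_all {T : Set Formula} (φ : Formula) :
    Deriv T [] (iff (all φ.shift) φ) :=
  .iff_of (by simpa [shift_inst] using Deriv.allE zeroTm (.hyp₀ (T := T) (Γ := [])
    (φ := all φ.shift))) (.allI .hyp₀)

theorem Deriv.iff_dummy_ex {T : Set Formula} (φ : Formula) :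
    Deriv T [] (iff (ex φ.shift) φ) :=
  .iff_of (.exE .hyp₀ .hyp₀) (.exI zeroTm (by rw [shift_inst]; exact .hyp₀))

theorem Deriv.iff_and {T : Set Formula} {φ ψ φ' ψ' : Formula} (h : Deriv T [] (iff φ φ'))
    (h' : Deriv T [] (iff ψ ψ')) : Deriv T [] (iff (and φ ψ) (and φ' ψ')) :=
  .iff_of (.andI (h.iff_mp (.andE₁ .hyp₀)) (h'.iff_mp (.andE₂ .hyp₀)))
    (.andI (h.iff_mpr (.andE₁ .hyp₀)) (h'.iff_mpr (.andE₂ .hyp₀)))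

theorem Deriv.iff_imp {T : Set Formula} {φ ψ φ' ψ' : Formula} (h : Deriv T [] (iff φ φ'))
    (h' : Deriv T [] (iff ψ ψ')) : Deriv T [] (iff (imp φ ψ) (imp φ' ψ')) :=
  .iff_of (.impI (h'.iff_mp (.impE .hyp₁ (h.iff_mpr .hyp₀))))
    (.impI (h'.iff_mpr (.impE .hyp₁ (h.iff_mp .hyp₀))))

/-! ### Countability of the syntax -/

/-- A numerical code of a code of a primitive recursive function. -/
def PRCode.num : {n : ℕ} → PRCode n → ℕ
  | _, .zero => Nat.pair 0 0
  | _, .succ => Nat.pair 1 0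
  | _, .proj i => Nat.pair 2 i
  | _, .comp (n := n) f g =>
    Nat.pair 3 (Nat.pair n (Nat.pair f.num (Encodable.encode (List.ofFn fun i => (g i).num))))
  | _, .prec f g => Nat.pair 4 (Nat.pair f.num g.num)

theorem PRCode.num_injective {n : ℕ} (c c' : PRCode n) (h : c.num = c'.num) : c = c' := by
  induction c with
  | zero => cases c' <;> simp_all [PRCode.num, Nat.pair_eq_pair]
  | succ => cases c' <;> simp_all [PRCode.num, Nat.pair_eq_pair]
  | proj i => cases c' <;> simp_all [PRCode.num, Nat.pair_eq_pair, Fin.ext_iff]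
  | comp f g ihf ihg =>
    cases c' with
    | comp f' g' =>
      simp only [PRCode.num, Nat.pair_eq_pair, true_and] at h
      obtain ⟨rfl, h₁, h₂⟩ := h
      have h₃ := List.ofFn_injective (Encodable.encode_injective h₂)
      rw [ihf f' h₁, funext fun i => ihg i (g' i) (congrFun h₃ i)]
    | _ => simp [PRCode.num, Nat.pair_eq_pair] at h
  | prec f g ihf ihg =>
    cases c' with
    | prec f' g' =>
      simp only [PRCode.num, Nat.pair_eq_pair, true_and] at h
      rw [ihf f' h.1, ihg g' h.2]
    | _ => simp [PRCode.num, Nat.pair_eq_pair] at h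

instance (n : ℕ) : Countable (PRCode n) :=
  Function.Injective.countable (f := PRCode.num) fun c c' h => c.num_injective c' h

instance (n : ℕ) : Countable (arith.Functions n) := inferInstanceAs (Countable (PRCode n))

/-- A numerical code of a formula, given codes of terms. -/
def Formula.num (e : Tm → ℕ) : Formula → ℕ
  | falsum => Nat.pair 0 0
  | eq t s => Nat.pair 1 (Nat.pair (e t) (e s))
  | and φ ψ => Nat.pair 2 (Nat.pair (φ.num e) (ψ.num e))
  | or φ ψ => Nat.pair 3 (Nat.pair (φ.num e) (ψ.num e))
  | imp φ ψ => Nat.pair 4 (Nat.pair (φ.num e) (ψ.num e))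
  | all φ => Nat.pair 5 (φ.num e)
  | ex φ => Nat.pair 6 (φ.num e)

/-- Countability allows a single ideal of conditions to meet one requirement for each formula. -/
instance : Countable Formula := by
  obtain ⟨e, he⟩ := exists_injective_nat Tm
  refine Function.Injective.countable (f := Formula.num e) ?_
  intro φ
  induction φ with
  | falsum => intro ψ h; cases ψ <;> simp_all [Formula.num, Nat.pair_eq_pair]
  | eq t s => intro ψ h; cases ψ <;> simp_all [Formula.num, Nat.pair_eq_pair, he.eq_iff]
  | and φ ψ h₁ h₂ =>
    intro ψ h
    cases ψ <;> simp [Formula.num, Nat.pair_eq_pair] at h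
    rw [h₁ h.1, h₂ h.2]
  | or φ ψ h₁ h₂ =>
    intro ψ h
    cases ψ <;> simp [Formula.num, Nat.pair_eq_pair] at h
    rw [h₁ h.1, h₂ h.2]
  | imp φ ψ h₁ h₂ =>
    intro ψ h
    cases ψ <;> simp [Formula.num, Nat.pair_eq_pair] at h
    rw [h₁ h.1, h₂ h.2]
  | all φ h₁ =>
    intro ψ h
    cases ψ <;> simp [Formula.num, Nat.pair_eq_pair] at h
    rw [h₁ h]
  | ex φ h₁ =>
    intro ψ h
    cases ψ <;> simp [Formula.num, Nat.pair_eq_pair] at h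
    rw [h₁ h]

/-! ### Classical semantics -/

/-- Classical truth of a formula in a structure. -/
def sat {M : Type} [arith.Structure M] : (ℕ → M) → Formula → Prop
  | _, .falsum => False
  | ρ, .eq t s => t.realize ρ = s.realize ρ
  | ρ, .and φ ψ => sat ρ φ ∧ sat ρ ψ
  | ρ, .or φ ψ => sat ρ φ ∨ sat ρ ψ
  | ρ, .imp φ ψ => sat ρ φ → sat ρ ψ
  | ρ, .all φ => ∀ m, sat (scons m ρ) φ
  | ρ, .ex φ => ∃ m, sat (scons m ρ) φ

theorem realize_v {M : Type} [arith.Structure M] (ρ : ℕ → M) (i : ℕ) : (v i).realize ρ = ρ i :=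
  rfl

theorem realize_scons {M : Type} [arith.Structure M] (ρ : ℕ → M) (t : Tm) (σ : ℕ → Tm) :
    (fun i => (scons t σ i).realize ρ) = scons (t.realize ρ) (fun i => (σ i).realize ρ) := by
  funext i; cases i <;> rfl

theorem realize_lift {M : Type} [arith.Structure M] (ρ : ℕ → M) (m : M) (σ : ℕ → Tm) :
    (fun i => (liftSubst σ i).realize (scons m ρ)) = scons m (fun i => (σ i).realize ρ) := by
  funext i
  cases i with
  | zero => rfl
  | succ i => simp only [liftSubst, Term.realize_relabel]; rfl

theorem sat_subst {M : Type} [arith.Structure M] (φ : Formula) (σ : ℕ → Tm) (ρ : ℕ → M) :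
    sat ρ (φ.subst σ) ↔ sat (fun i => (σ i).realize ρ) φ := by
  induction φ generalizing σ ρ with
  | falsum => rfl
  | eq t s => simp [Formula.subst, sat, Term.realize_subst]
  | and φ ψ h₁ h₂ => simp [Formula.subst, sat, h₁, h₂]
  | or φ ψ h₁ h₂ => simp [Formula.subst, sat, h₁, h₂]
  | imp φ ψ h₁ h₂ => simp [Formula.subst, sat, h₁, h₂]
  | all φ h => simp only [Formula.subst, sat, h, realize_lift]
  | ex φ h => simp only [Formula.subst, sat, h, realize_lift]

theorem sat_inst {M : Type} [arith.Structure M] (φ : Formula) (t : Tm) (ρ : ℕ → M) :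
    sat ρ (φ.inst t) ↔ sat (scons (t.realize ρ) ρ) φ := by
  rw [Formula.inst, sat_subst, instSubst_eq, realize_scons]; rfl

theorem sat_shift {M : Type} [arith.Structure M] (φ : Formula) (m : M) (ρ : ℕ → M) :
    sat (scons m ρ) φ.shift ↔ sat ρ φ := by
  rw [Formula.shift, sat_subst]; rfl

/-- Models of classical first-order arithmetic. -/
class IsPA (M : Type) [arith.Structure M] : Prop where
  sat_ax : ∀ φ, IsArithAx φ → ∀ ρ : ℕ → M, sat ρ φ

/-- Truth in all models of classical arithmetic. -/
def Valid (φ : Formula) : Prop := ∀ (M : Type) [arith.Structure M] [IsPA M] (ρ : ℕ → M), sat ρ φ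

/-! ### The negative translation -/

/-- The formula with disjunctions and existential quantifiers replaced by their
classical definitions. -/
def Formula.negTr : Formula → Formula
  | falsum => falsum
  | eq t s => eq t s
  | and φ ψ => and φ.negTr ψ.negTr
  | or φ ψ => neg (and (neg φ.negTr) (neg ψ.negTr))
  | imp φ ψ => imp φ.negTr ψ.negTr
  | all φ => all φ.negTr
  | ex φ => neg (all (neg φ.negTr))

/-- Formulas without disjunction and existential quantifier. -/
def Formula.IsNegative : Formula → Prop
  | falsum => True
  | eq _ _ => True
  | and φ ψ => φ.IsNegative ∧ ψ.IsNegative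
  | or _ _ => False
  | imp φ ψ => φ.IsNegative ∧ ψ.IsNegative
  | all φ => φ.IsNegative
  | ex _ => False

theorem isNegative_negTr (φ : Formula) : φ.negTr.IsNegative := by
  induction φ <;> simp_all [Formula.negTr, IsNegative, neg]

theorem IsNegative.subst {φ : Formula} (h : φ.IsNegative) (σ : ℕ → Tm) :
    (φ.subst σ).IsNegative := by
  induction φ generalizing σ <;> simp_all [Formula.subst, IsNegative]

theorem sat_neg {M : Type} [arith.Structure M] (ρ : ℕ → M) (φ : Formula) :
    sat ρ (neg φ) ↔ ¬ sat ρ φ := Iff.rfl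

theorem sat_negTr {M : Type} [arith.Structure M] (ρ : ℕ → M) (φ : Formula) :
    sat ρ φ.negTr ↔ sat ρ φ := by
  induction φ generalizing ρ with
  | falsum => rfl
  | eq t s => rfl
  | and φ ψ h₁ h₂ => simp [Formula.negTr, sat, h₁, h₂]
  | or φ ψ h₁ h₂ => simp [Formula.negTr, sat, sat_neg, h₁, h₂]; tauto
  | imp φ ψ h₁ h₂ => simp [Formula.negTr, sat, h₁, h₂]
  | all φ h => simp [Formula.negTr, sat, h]
  | ex φ h => simp [Formula.negTr, sat, sat_neg, h]

/-- Double negation elimination is provable for `φ`. -/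
def Stable (T : Set Formula) (φ : Formula) : Prop := Deriv T [] (imp (neg (neg φ)) φ)

theorem Stable.dne {T : Set Formula} {φ : Formula} (h : Stable T φ) {Γ : List Formula}
    (h' : Deriv T (neg φ :: Γ) falsum) : Deriv T Γ φ := .mp h (.impI h')

theorem Stable.and {T : Set Formula} {φ ψ : Formula} (h : Stable T φ) (h' : Stable T ψ) :
    Stable T (Formula.and φ ψ) :=
  .impI (.andI (h.dne (.impE .hyp₁ (.impI (.impE .hyp₁ (.andE₁ .hyp₀)))))
    (h'.dne (.impE .hyp₁ (.impI (.impE .hyp₁ (.andE₂ .hyp₀))))))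

theorem Stable.imp {T : Set Formula} {φ ψ : Formula} (h : Stable T ψ) : Stable T (imp φ ψ) :=
  .impI (.impI (h.dne (.impE .hyp₂ (.impI (.impE .hyp₁ (.impE .hyp₀ .hyp₂))))))

theorem Stable.all {T : Set Formula} {φ : Formula} (h : Stable T φ) : Stable T (all φ) :=
  .impI (.allI (h.dne (.impE (φ := (Formula.all φ).neg.shift) .hyp₁
    (.impI (.impE .hyp₁ (.allE_shift .hyp₀))))))

/-- Conjunction, universal quantification and implication preserve stability, the last one needing
it of the conclusion only; what remains to be assumed is stability of equations. -/
theorem Stable.of_isNegative {T : Set Formula} (hT : ∀ t s, Stable T (eq t s)) {φ : Formula}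
    (hφ : φ.IsNegative) : Stable T φ := by
  induction φ with
  | falsum => exact .impI (.impE .hyp₀ (.impI .hyp₀))
  | eq t s => exact hT t s
  | and φ ψ h₁ h₂ => exact (h₁ hφ.1).and (h₂ hφ.2)
  | or φ ψ h₁ h₂ => exact hφ.elim
  | imp φ ψ h₁ h₂ => exact (h₂ hφ.2).imp
  | all φ h => exact (h hφ).all
  | ex φ h => exact hφ.elim

/-! ### Equality -/

theorem Deriv.eq_symm {T : Set Formula} {Γ : List Formula} {t s : Tm} (h : Deriv T Γ (eq t s)) :
    Deriv T Γ (eq s t) := by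
  have := Deriv.eqE (eq (v 0) (t.subst fun i => v (i + 1))) h
  simp only [Formula.inst, Formula.subst, tm_subst_subst, v_subst, instSubst] at this
  rw [show (fun i => v i) = v from rfl, tm_subst_v] at this
  exact this (.eqI t)

theorem Deriv.eq_trans {T : Set Formula} {Γ : List Formula} {t s u : Tm} (h : Deriv T Γ (eq t s))
    (h' : Deriv T Γ (eq s u)) : Deriv T Γ (eq t u) := by
  have := Deriv.eqE (eq (t.subst fun i => v (i + 1)) (v 0)) h'
  simp only [Formula.inst, Formula.subst, tm_subst_subst, v_subst, instSubst] at this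
  rw [show (fun i => v i) = v from rfl, tm_subst_v] at this
  exact this h

theorem Deriv.eq_app {T : Set Formula} {Γ : List Formula} {n : ℕ} (f : PRCode n)
    (ts ss : Fin n → Tm) (h : ∀ i, Deriv T Γ (eq (ts i) (ss i))) :
    Deriv T Γ (eq (app f ts) (app f ss)) := by
  -- The equality rule handles one equation at a time, so the arguments are exchanged one by one;
  -- the first `k` have been exchanged.
  have key : ∀ k : ℕ, Deriv T Γ (eq (app f ts) (app f fun i => if i.1 < k then ss i else ts i)) := by
    intro k
    induction k with
    | zero => simpa using Deriv.eqI _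
    | succ k ih =>
      by_cases hk : k < n
      · have := Deriv.eqE (eq ((app f ts).subst fun i => v (i + 1)) (app f fun i =>
          if i.1 < k then (ss i).subst (fun i => v (i + 1)) else if i.1 = k then v 0
            else (ts i).subst (fun i => v (i + 1)))) (h ⟨k, hk⟩)
        have e : ∀ t : Tm, (Formula.inst (eq ((app f ts).subst fun i => v (i + 1)) (app f fun i =>
          if i.1 < k then (ss i).subst (fun i => v (i + 1)) else if i.1 = k then v 0
            else (ts i).subst (fun i => v (i + 1)))) t) = eq (app f ts) (app f fun i =>
            if i.1 < k then ss i else if i.1 = k then t else ts i) := by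
          intro t
          simp only [Formula.inst, Formula.subst, tm_subst_subst, v_subst, instSubst]
          rw [show (fun i => v i) = v from rfl, tm_subst_v]
          congr 1
          simp only [app, Term.subst]
          congr 1
          funext i
          split_ifs
          · rw [tm_subst_subst]; exact tm_subst_v _
          · rfl
          · rw [tm_subst_subst]; exact tm_subst_v _
        rw [e, e] at this
        have e₁ : (fun i : Fin n => if i.1 < k then ss i else if i.1 = k then ts ⟨k, hk⟩ else ts i)
            = fun i => if i.1 < k then ss i else ts i := by
          funext i
          split_ifs with h₁ h₂
          · rfl
          · congr 1; exact Fin.ext h₂.symm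
          · rfl
        have e₂ : (fun i : Fin n => if i.1 < k then ss i else if i.1 = k then ss ⟨k, hk⟩ else ts i)
            = fun i => if i.1 < k + 1 then ss i else ts i := by
          funext i
          by_cases h₁ : i.1 < k
          · simp [h₁, h₁.trans (Nat.lt_succ_self k)]
          · by_cases h₂ : i.1 = k
            · subst h₂; simp
            · have : ¬ i.1 < k + 1 := by omega
              simp [h₁, h₂, this]
        rw [e₁, e₂] at this
        exact this ih
      · convert ih using 3
        funext i
        have h₁ : i.1 < k := by omega
        simp [h₁, h₁.trans (Nat.lt_succ_self k)]
  simpa using key n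

/-! ### Completeness for negative formulas -/

section Completeness

variable {T : Set Formula}

/-- The finite consistent extensions of `T` by negative formulas. -/
def Cond (T : Set Formula) : Type := {p : Formula // p.IsNegative ∧ ¬ Deriv T [p] falsum}

/-- Larger conditions are stronger, so generic objects are ideals and directedness provides common
strengthenings. -/
instance : Preorder (Cond T) where
  le p q := Deriv T [q.1] p.1
  le_refl _ := .hyp₀
  le_trans _ _ _ h h' := .cut_single h' h

/-- The formulas that some condition in `G` derives. -/
def Forced (G : Order.Ideal (Cond T)) (φ : Formula) : Prop := ∃ p ∈ G, Deriv T [p.1] φ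

theorem Forced.deriv₂ {G : Order.Ideal (Cond T)} {φ ψ χ : Formula} (h : Deriv T [ψ, φ] χ)
    (hφ : Forced G φ) (hψ : Forced G ψ) : Forced G χ := by
  obtain ⟨p, hp, hp'⟩ := hφ
  obtain ⟨q, hq, hq'⟩ := hψ
  obtain ⟨r, hr, hpr, hqr⟩ := G.directed p hp q hq
  exact ⟨r, hr, .cut (.cut_single hpr hp') (.cut ((Deriv.cut_single hqr hq').weaken (by simp))
    (h.weaken (by intro x; simp; tauto)))⟩

theorem Forced.deriv {G : Order.Ideal (Cond T)} {φ χ : Formula} (h : Deriv T [φ] χ)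
    (hφ : Forced G φ) : Forced G χ := hφ.deriv₂ (h.weaken (by simp)) hφ

theorem Forced.of_deriv {G : Order.Ideal (Cond T)} {φ : Formula} (h : Deriv T [] φ) :
    Forced G φ := by
  obtain ⟨p, hp⟩ := G.nonempty
  exact ⟨p, hp, h.lift⟩

theorem not_forced_falsum {G : Order.Ideal (Cond T)} : ¬ Forced G falsum :=
  fun ⟨p, _, h⟩ => p.2.2 h

/-- An ideal of conditions that decides all negative formulas and has counterexamples to all
universal formulas that it refutes. -/
structure Generic (G : Order.Ideal (Cond T)) : Prop where
  decides : ∀ φ : Formula, φ.IsNegative → Forced G φ ∨ Forced G (neg φ)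
  witness : ∀ φ : Formula, φ.IsNegative →
    Forced G (all φ) ∨ ∃ t, Forced G (neg (φ.inst t))

/-- If `p` were inconsistent with `¬φ`, it would derive `¬¬φ` and, by stability, `φ`. -/
theorem Stable.exists_cond {φ : Formula} (hs : Stable T φ) (hφ : φ.IsNegative) (p : Cond T)
    (h : ¬ Deriv T [p.1] φ) : ∃ q : Cond T, p ≤ q ∧ Deriv T [q.1] (neg φ) :=
  ⟨⟨Formula.and p.1 (neg φ), ⟨p.2.1, hφ, trivial⟩, fun h' => h (hs.dne
    (.cut (.andI .hyp₁ .hyp₀) (h'.weaken (by simp))))⟩, .andE₁ .hyp₀, .andE₂ .hyp₀⟩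

/-- The variable `m` occurs neither in `p` nor in `∀φ`. Renaming it to `0` and raising all others
turns the derivation into the premise of `allI`. -/
theorem Deriv.all_of_fresh {p φ : Formula} {m : ℕ} (hp : p.fvBound ≤ m)
    (hφ : (all φ).fvBound ≤ m) (h : Deriv T [p] (φ.inst (v m))) : Deriv T [p] (all φ) := by
  have h₁ := (Deriv.impI h).subst (fun i => if i = m then v 0 else v (i + 1))
  have e₁ : p.subst (fun i => if i = m then v 0 else v (i + 1)) = p.shift :=
    subst_congr p fun i hi => if_neg (by omega)
  have e₂ : (φ.inst (v m)).subst (fun i => if i = m then v 0 else v (i + 1)) = φ := by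
    rw [Formula.inst, subst_subst]
    conv_rhs => rw [← subst_v φ]
    refine subst_congr φ fun i hi => ?_
    cases i with
    | zero => simp [instSubst, v_subst]
    | succ i =>
      simp only [Formula.fvBound] at hφ
      simp only [instSubst, v_subst]
      exact if_neg (by omega)
  simp only [Formula.subst, e₁, e₂] at h₁
  exact .allI (.impE h₁.lift .hyp₀)

/-- The Rasiowa–Sikorski argument: each requirement defines a cofinal set of conditions, because a
condition that fails to derive a stable formula can be strengthened by its negation. -/
theorem exists_generic (hT : ∀ t s, Stable T (eq t s)) (p : Cond T) :
    ∃ G : Order.Ideal (Cond T), p ∈ G ∧ Generic G := by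
  have : Nonempty (Encodable (Formula × Bool)) := nonempty_encodable _
  obtain ⟨_⟩ := this
  have hst : ∀ {φ : Formula}, φ.IsNegative → Stable T φ := fun h => Stable.of_isNegative hT h
  have hd : ∀ φ : Formula, IsCofinal {p : Cond T | φ.IsNegative →
      Deriv T [p.1] φ ∨ Deriv T [p.1] (neg φ)} := by
    intro φ p
    by_cases h : φ.IsNegative → Deriv T [p.1] φ
    · exact ⟨p, fun hn => .inl (h hn), le_rfl⟩
    · rw [Classical.not_imp] at h
      obtain ⟨q, hq, hq'⟩ := (hst h.1).exists_cond h.1 p h.2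
      exact ⟨q, fun _ => .inr hq', hq⟩
  have hw : ∀ φ : Formula, IsCofinal {p : Cond T | φ.IsNegative →
      Deriv T [p.1] (all φ) ∨ ∃ t, Deriv T [p.1] (neg (φ.inst t))} := by
    intro φ p
    by_cases h : φ.IsNegative → Deriv T [p.1] (all φ)
    · exact ⟨p, fun hn => .inl (h hn), le_rfl⟩
    · rw [Classical.not_imp] at h
      -- A variable fresh for the condition and the formula serves as the counterexample.
      have hn := IsNegative.subst h.1 (instSubst (v (max p.1.fvBound (all φ).fvBound)))
      obtain ⟨q, hq, hq'⟩ := (hst hn).exists_cond hn p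
        fun h' => h.2 (.all_of_fresh (le_max_left _ _) (le_max_right _ _) h')
      exact ⟨q, fun _ => .inr ⟨_, hq'⟩, hq⟩
  let 𝒟 : Formula × Bool → Order.Cofinal (Cond T) := fun x =>
    if x.2 then ⟨_, hd x.1⟩ else ⟨_, hw x.1⟩
  refine ⟨Order.idealOfCofinals p 𝒟, Order.mem_idealOfCofinals p 𝒟, ?_, ?_⟩
  · intro φ hφ
    obtain ⟨q, hq, hq'⟩ := Order.cofinal_meets_idealOfCofinals p 𝒟 (φ, true)
    exact (hq hφ).imp (fun h => ⟨q, hq', h⟩) fun h => ⟨q, hq', h⟩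
  · intro φ hφ
    obtain ⟨q, hq, hq'⟩ := Order.cofinal_meets_idealOfCofinals p 𝒟 (φ, false)
    exact (hq hφ).imp (fun h => ⟨q, hq', h⟩) fun ⟨t, h⟩ => ⟨t, q, hq', h⟩

-- The term model of a generic ideal

/-- Forced equality of terms. -/
def tmSetoid (G : Order.Ideal (Cond T)) : Setoid Tm where
  r t s := Forced G (eq t s)
  iseqv := ⟨fun t => .of_deriv (.eqI t), fun h => h.deriv (.eq_symm .hyp₀),
    fun h h' => h.deriv₂ (.eq_trans .hyp₁ .hyp₀) h'⟩

/-- The model of terms modulo forced equality. -/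
def TermModel (G : Order.Ideal (Cond T)) : Type := Quotient (tmSetoid G)

/-- The element of the model that a term denotes. -/
def TermModel.mk (G : Order.Ideal (Cond T)) (t : Tm) : TermModel G := Quotient.mk _ t

theorem TermModel.mk_eq {G : Order.Ideal (Cond T)} {t s : Tm} :
    TermModel.mk G t = TermModel.mk G s ↔ Forced G (eq t s) := Quotient.eq (r := tmSetoid G)

theorem TermModel.exists_mk {G : Order.Ideal (Cond T)} (ρ : ℕ → TermModel G) :
    ∃ σ : ℕ → Tm, ρ = fun i => TermModel.mk G (σ i) :=
  ⟨fun i => (ρ i).out, funext fun _ => (Quotient.out_eq _).symm⟩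

/-- Functions act on chosen representatives; `Forced.eq_app` shows that the choice does not matter.
-/
noncomputable instance (G : Order.Ideal (Cond T)) : arith.Structure (TermModel G) where
  funMap f xs := TermModel.mk G (app f fun i => (xs i).out)
  RelMap r := nomatch r

/-- Different conditions may force the equations of the arguments; being finitely many, they have a
common bound in the ideal. -/
theorem Forced.eq_app {G : Order.Ideal (Cond T)} {n : ℕ} (f : PRCode n) (ts ss : Fin n → Tm)
    (h : ∀ i, Forced G (eq (ts i) (ss i))) : Forced G (eq (app f ts) (app f ss)) := by
  choose p hp hp' using h
  have : ∀ s : Finset (Fin n), ∃ q ∈ G, ∀ i ∈ s, p i ≤ q := by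
    intro s
    induction s using Finset.induction_on with
    | empty => exact G.nonempty.imp fun q hq => ⟨hq, by simp⟩
    | insert i s _ ih =>
      obtain ⟨q, hq, hq'⟩ := ih
      obtain ⟨r, hr, hir, hqr⟩ := G.directed _ (hp i) _ hq
      refine ⟨r, hr, fun j hj => ?_⟩
      rcases Finset.mem_insert.1 hj with rfl | hj
      · exact hir
      · exact (hq' j hj).trans hqr
  obtain ⟨q, hq, hq'⟩ := this Finset.univ
  exact ⟨q, hq, .eq_app f ts ss fun i => .cut_single (hq' i (Finset.mem_univ _)) (hp' i)⟩

theorem TermModel.realize {G : Order.Ideal (Cond T)} (σ : ℕ → Tm) (t : Tm) :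
    t.realize (fun i => TermModel.mk G (σ i)) = TermModel.mk G (t.subst σ) := by
  induction t with
  | var i => rfl
  | func f ts ih =>
    simp only [Term.realize, ih]
    refine TermModel.mk_eq.2 (Forced.eq_app f _ _ fun i => ?_)
    exact TermModel.mk_eq.1 (Quotient.out_eq _)

theorem mk_scons {G : Order.Ideal (Cond T)} (t : Tm) (σ : ℕ → Tm) :
    scons (TermModel.mk G t) (fun i => TermModel.mk G (σ i)) =
      fun i => TermModel.mk G (scons t σ i) := by
  funext i; cases i <;> rfl

/-- The truth lemma. Deciding every negative formula settles implication, and counterexamples settle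
the universal quantifier; negativity leaves no disjunction or existential formula to treat. -/
theorem Generic.sat_iff {G : Order.Ideal (Cond T)} (hG : Generic G) {φ : Formula}
    (hφ : φ.IsNegative) (σ : ℕ → Tm) :
    sat (fun i => TermModel.mk G (σ i)) φ ↔ Forced G (φ.subst σ) := by
  induction φ generalizing σ with
  | falsum => exact ⟨False.elim, not_forced_falsum⟩
  | eq t s => simp only [sat, TermModel.realize, TermModel.mk_eq, Formula.subst]
  | and φ ψ h₁ h₂ =>
    simp only [sat, h₁ hφ.1, h₂ hφ.2, Formula.subst]
    exact ⟨fun h => h.1.deriv₂ (.andI .hyp₁ .hyp₀) h.2,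
      fun h => ⟨h.deriv (.andE₁ .hyp₀), h.deriv (.andE₂ .hyp₀)⟩⟩
  | or φ ψ h₁ h₂ => exact hφ.elim
  | imp φ ψ h₁ h₂ =>
    simp only [sat, h₁ hφ.1, h₂ hφ.2, Formula.subst]
    refine ⟨fun h => ?_, fun h h' => h.deriv₂ (.impE .hyp₁ .hyp₀) h'⟩
    rcases hG.decides _ (IsNegative.subst hφ.1 σ) with h' | h'
    · exact (h h').deriv (.impI .hyp₁)
    · exact h'.deriv (.impI (.falsumE (.impE .hyp₁ .hyp₀)))
  | all φ ih =>
    simp only [sat, Formula.subst]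
    constructor
    · intro h
      rcases hG.witness _ (IsNegative.subst (φ := φ) hφ (liftSubst σ)) with h' | ⟨t, h'⟩
      · exact h'
      · have := h (TermModel.mk G t)
        rw [mk_scons, ih hφ, ← inst_subst_lift] at this
        exact (not_forced_falsum (h'.deriv₂ (.impE .hyp₁ .hyp₀) this)).elim
    · intro h m
      obtain ⟨t, rfl⟩ : ∃ t, m = TermModel.mk G t := ⟨m.out, (Quotient.out_eq _).symm⟩
      rw [mk_scons, ih hφ, ← inst_subst_lift]
      exact h.deriv (.allE t .hyp₀)
  | ex φ h => exact hφ.elim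

theorem sat_induction_congr {M : Type} [arith.Structure M] {φ ψ : Formula}
    (h : ∀ ρ : ℕ → M, sat ρ φ ↔ sat ρ ψ) (ρ : ℕ → M) :
    sat ρ (imp (φ.inst zeroTm) (imp (all (imp φ (φ.subst succSubst))) (all φ))) ↔
      sat ρ (imp (ψ.inst zeroTm) (imp (all (imp ψ (ψ.subst succSubst))) (all ψ))) := by
  simp only [sat, Formula.inst, sat_subst, h]

/-- The truth lemma covers negative formulas only. Every axiom except induction is negative, and
induction for `φ` has the same classical truth value as induction for `φ.negTr`, which is a negative
axiom. -/
theorem Generic.isPA {G : Order.Ideal (Cond T)} (hG : Generic G) (hT : HA ⊆ T) :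
    IsPA (TermModel G) := by
  have key : ∀ φ : Formula, φ.IsNegative → IsArithAx φ → ∀ ρ : ℕ → TermModel G, sat ρ φ := by
    intro φ hn hφ ρ
    obtain ⟨σ, rfl⟩ := TermModel.exists_mk ρ
    rw [hG.sat_iff hn]
    exact .of_deriv ((Deriv.of_closure_mem (hT ⟨φ, hφ, rfl⟩)).subst σ)
  refine ⟨fun φ hφ => ?_⟩
  cases hφ with
  | induction φ =>
    intro ρ
    rw [← sat_induction_congr fun ρ => sat_negTr ρ φ]
    have hn := isNegative_negTr φ
    refine key _ ?_ (.induction φ.negTr) ρ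
    exact ⟨IsNegative.subst hn _, ⟨hn, IsNegative.subst hn _⟩, hn⟩
  | succNeZero => exact key _ ⟨trivial, trivial⟩ .succNeZero
  | succInj => exact key _ ⟨trivial, trivial⟩ .succInj
  | projEq i => exact key _ trivial (.projEq i)
  | compEq f g => exact key _ trivial (.compEq f g)
  | precZero f g => exact key _ trivial (.precZero f g)
  | precSucc f g => exact key _ trivial (.precSucc f g)

/-- Completeness: a negative formula true in all models of classical arithmetic is derivable
from every extension of Heyting arithmetic with stable equality. -/
theorem Deriv.of_valid_of_isNegative (hT : HA ⊆ T) (hT' : ∀ t s, Stable T (eq t s)) {φ : Formula}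
    (hφ : φ.IsNegative) (h : Valid φ) : Deriv T [] φ := by
  by_contra hd
  obtain ⟨G, hG, hG'⟩ := exists_generic hT' ⟨neg φ, ⟨hφ, trivial⟩, fun h' => hd
    ((Stable.of_isNegative hT' hφ).dne h')⟩
  have := hG'.isPA hT
  have h₁ := (hG'.sat_iff hφ v).1 (h _ _)
  rw [subst_v] at h₁
  exact not_forced_falsum (Forced.deriv₂ (.impE .hyp₁ .hyp₀) ⟨_, hG, .hyp₀⟩ h₁)

end Completeness

/-! ### Transfer of classical validity -/

/-- `T` proves the equivalence of `φ` and its negative translation. -/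
def Good (T : Set Formula) (φ : Formula) : Prop := Deriv T [] (iff φ φ.negTr)

theorem Good.falsum {T : Set Formula} : Good T falsum := .iff_refl _

theorem Good.eq {T : Set Formula} (t s : Tm) : Good T (eq t s) := .iff_refl _

theorem Good.and {T : Set Formula} {φ ψ : Formula} (h : Good T φ) (h' : Good T ψ) :
    Good T (and φ ψ) := Deriv.iff_and h h'

theorem Good.imp {T : Set Formula} {φ ψ : Formula} (h : Good T φ) (h' : Good T ψ) :
    Good T (imp φ ψ) := Deriv.iff_imp h h'

theorem Good.neg {T : Set Formula} {φ : Formula} (h : Good T φ) : Good T (neg φ) :=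
  h.imp .falsum

theorem Good.all {T : Set Formula} {φ : Formula} (h : Good T φ) : Good T (all φ) :=
  Deriv.iff_all h

/-- The negative translation of a disjunction, as of an existential formula, only returns its double
negation; the stability hypothesis removes it. -/
theorem Good.or {T : Set Formula} {φ ψ : Formula} (h : Good T φ) (h' : Good T ψ)
    (hs : Stable T (or φ ψ)) : Good T (or φ ψ) :=
  .iff_of
    (.impI (.orE .hyp₁ (.impE (.andE₁ .hyp₁) (h.iff_mp .hyp₀))
      (.impE (.andE₂ .hyp₁) (h'.iff_mp .hyp₀))))
    (hs.dne (.impE .hyp₁ (.andI (.impI (.impE .hyp₁ (.orI₁ (h.iff_mpr .hyp₀))))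
      (.impI (.impE .hyp₁ (.orI₂ (h'.iff_mpr .hyp₀)))))))

theorem Good.ex {T : Set Formula} {φ : Formula} (h : Good T φ) (hs : Stable T (ex φ)) :
    Good T (ex φ) :=
  .iff_of
    (.impI (.exE .hyp₁ (.impE (φ := φ.negTr)
      (.allE_shift (φ := φ.negTr.neg) .hyp₁) (h.iff_mp .hyp₀))))
    (hs.dne (.impE .hyp₁ (.allI (.impI
      (.impE (φ := (Formula.ex φ).shift) (ψ := .falsum) .hyp₁ (.exI_shift (h.iff_mpr .hyp₀)))))))

/-- Classically valid formulas are derivable if they are equivalent to their negative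
translations. -/
theorem Good.deriv {T : Set Formula} {φ : Formula} (h : Good T φ) (hT : HA ⊆ T)
    (hT' : ∀ t s, Stable T (Formula.eq t s)) (hv : Valid φ) : Deriv T [] φ :=
  h.iff_mpr (.of_valid_of_isNegative hT hT' (isNegative_negTr φ) fun _ _ _ ρ =>
    (sat_negTr ρ φ).2 (hv _ ρ))

theorem Good.deriv_iff {T : Set Formula} {φ ψ : Formula} (h : Good T φ) (h' : Good T ψ)
    (hT : HA ⊆ T) (hT' : ∀ t s, Stable T (Formula.eq t s))
    (hv : ∀ (M : Type) [arith.Structure M] [IsPA M] (ρ : ℕ → M), sat ρ φ ↔ sat ρ ψ) :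
    Deriv T [] (iff φ ψ) :=
  Good.deriv (h.imp h' |>.and (h'.imp h)) hT hT' fun M _ _ ρ => ⟨(hv M ρ).1, (hv M ρ).2⟩

/-! ### Arithmetic in models -/

theorem scons_fin {α : Type*} {n : ℕ} (a : α) (ρ : ℕ → α) :
    (fun j : Fin (n + 1) => scons a ρ j) = Fin.cons a fun j : Fin n => ρ j := by
  funext j
  refine Fin.cases ?_ (fun j => ?_) j <;> simp

section Model

variable {M : Type} [arith.Structure M]

/-- The function that a code denotes. -/
def ev {n : ℕ} (f : PRCode n) (xs : Fin n → M) : M := Structure.funMap (L := arith) f xs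

/-- The zero of a model. -/
def zr : M := ev PRCode.zero Fin.elim0

/-- The successor of a model. -/
def sc (x : M) : M := ev PRCode.succ fun _ => x

theorem realize_app {n : ℕ} (f : PRCode n) (ts : Fin n → Tm) (ρ : ℕ → M) :
    (app f ts).realize ρ = ev f fun i => (ts i).realize ρ := rfl

theorem realize_zeroTm (ρ : ℕ → M) : zeroTm.realize ρ = zr := by
  rw [zeroTm, realize_app, zr]; congr 1; funext i; exact i.elim0

theorem realize_succTm (t : Tm) (ρ : ℕ → M) : (succTm t).realize ρ = sc (t.realize ρ) := rfl

theorem realize_cons {n : ℕ} (t : Tm) (ts : Fin n → Tm) (ρ : ℕ → M) :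
    (fun i => (Fin.cons t ts : Fin (n + 1) → Tm) i |>.realize ρ) =
      Fin.cons (t.realize ρ) fun i => (ts i).realize ρ := by
  funext i
  refine Fin.cases ?_ (fun i => ?_) i <;> simp

/-- The assignment that begins with a tuple and continues with zeros. -/
def envOf {n : ℕ} (xs : Fin n → M) (i : ℕ) : M := if h : i < n then xs ⟨i, h⟩ else zr

theorem envOf_fin {n : ℕ} (xs : Fin n → M) : (fun j : Fin n => envOf xs j) = xs := by
  funext j; simp [envOf]

theorem envOf_cons {n : ℕ} (a : M) (xs : Fin n → M) :
    envOf (Fin.cons a xs : Fin (n + 1) → M) = scons a (envOf xs) := by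
  funext i
  cases i with
  | zero => rfl
  | succ i =>
    simp only [envOf, scons_succ, Nat.add_lt_add_iff_right]
    split_ifs with h
    · exact Fin.cons_succ (α := fun _ => M) a xs ⟨i, h⟩
    · rfl

theorem realize_congr (t : Tm) {ρ ρ' : ℕ → M} (h : ∀ i < t.varFinset.sup Nat.succ, ρ i = ρ' i) :
    t.realize ρ = t.realize ρ' := by
  induction t with
  | var i => exact h i (by simp [Term.varFinset])
  | func f ts ih =>
    simp only [Term.realize]; congr 1; funext i
    refine ih i (fun j hj => h j (hj.trans_le ?_))
    apply Finset.sup_mono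
    intro x hx
    simp only [Term.varFinset, Finset.mem_biUnion]
    exact ⟨i, Finset.mem_univ _, hx⟩

end Model

/-- A code of the function that a term in the first `n` variables defines. -/
def codeOf (n : ℕ) : Tm → PRCode n
  | .var i => if h : i < n then .proj ⟨i, h⟩ else .comp .zero Fin.elim0
  | .func f ts => .comp f fun i => codeOf n (ts i)

/-- A code of the function defined by primitive recursion from terms. -/
def recCode (n : ℕ) (b g : Tm) : PRCode (n + 1) := .prec (codeOf n b) (codeOf (n + 2) g)

/-- The application of a unary code. -/
def ap1 (c : PRCode 1) (t : Tm) : Tm := app c (Fin.cons t Fin.elim0)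

/-- The application of a binary code. -/
def ap2 (c : PRCode 2) (t s : Tm) : Tm := app c (Fin.cons t (Fin.cons s Fin.elim0))

/-- The application of a ternary code. -/
def ap3 (c : PRCode 3) (t s u : Tm) : Tm :=
  app c (Fin.cons t (Fin.cons s (Fin.cons u Fin.elim0)))

section PA

variable {M : Type} [arith.Structure M]

/-- The unary function that a code denotes. -/
def op1 (c : PRCode 1) (a : M) : M := ev c (Fin.cons a Fin.elim0)

/-- The binary function that a code denotes. -/
def op2 (c : PRCode 2) (a b : M) : M := ev c (Fin.cons a (Fin.cons b Fin.elim0))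

/-- The ternary function that a code denotes. -/
def op3 (c : PRCode 3) (a b d : M) : M :=
  ev c (Fin.cons a (Fin.cons b (Fin.cons d Fin.elim0)))

theorem realize_ap1 (c : PRCode 1) (t : Tm) (ρ : ℕ → M) :
    (ap1 c t).realize ρ = op1 c (t.realize ρ) := by
  rw [ap1, realize_app, realize_cons, op1]; congr 2; funext i; exact i.elim0

theorem realize_ap2 (c : PRCode 2) (t s : Tm) (ρ : ℕ → M) :
    (ap2 c t s).realize ρ = op2 c (t.realize ρ) (s.realize ρ) := by
  rw [ap2, realize_app, realize_cons, realize_cons, op2]; congr 3; funext i; exact i.elim0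

theorem realize_ap3 (c : PRCode 3) (t s u : Tm) (ρ : ℕ → M) :
    (ap3 c t s u).realize ρ = op3 c (t.realize ρ) (s.realize ρ) (u.realize ρ) := by
  rw [ap3, realize_app, realize_cons, realize_cons, realize_cons, op3]
  congr 4; funext i; exact i.elim0

/-! ### Some primitive recursive functions -/

/-- Addition. -/
def addC : PRCode 2 := recCode 1 (v 0) (succTm (v 1))

/-- Predecessor. -/
def predC : PRCode 1 := recCode 0 zeroTm (v 0)

/-- Truncated subtraction of the first argument from the second. -/
def subC : PRCode 2 := recCode 1 (v 0) (ap1 predC (v 1))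

/-- Distinction of cases by whether the first argument is zero. -/
def iteC : PRCode 3 := recCode 2 (v 0) (v 3)

/-- Triangular numbers. -/
def triC : PRCode 1 := recCode 0 zeroTm (ap2 addC (succTm (v 0)) (v 1))

/-- The distance of two numbers. -/
def distTm (t s : Tm) : Tm := ap2 addC (ap2 subC t s) (ap2 subC s t)

/-- The index of the diagonal on which the Cantor pair with a given code lies. -/
def diagC : PRCode 1 := recCode 0 zeroTm
  (ap3 iteC (distTm (succTm (v 0)) (ap1 triC (succTm (v 1)))) (succTm (v 1)) (v 1))

/-- The second component of a pair. -/
def sndTm (t : Tm) : Tm := ap2 subC (ap1 triC (ap1 diagC t)) t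

/-- The first component of a pair. -/
def fstTm (t : Tm) : Tm := ap2 subC (sndTm t) (ap1 diagC t)

/-- The Cantor pair. -/
def pairTm (t s : Tm) : Tm := ap2 addC s (ap1 triC (ap2 addC s t))

/-- Iterated second components. -/
def tailC : PRCode 2 := recCode 1 (v 0) (sndTm (v 1))

/-- An entry of the sequence that a number codes. -/
def entryTm (d s : Tm) : Tm := fstTm (ap2 tailC d s)

/-- The Cantor pair in a model. -/
def pr (a b : M) : M := (pairTm (v 0) (v 1)).realize (scons a fun _ => b)

/-- The first component in a model. -/
def fs (a : M) : M := (fstTm (v 0)).realize fun _ => a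

/-- The second component in a model. -/
def sn (a : M) : M := (sndTm (v 0)).realize fun _ => a

/-- The entries of a sequence in a model. -/
def entry (d s : M) : M := fs (op2 tailC d s)

theorem realize_fstTm (t : Tm) (ρ : ℕ → M) : (fstTm t).realize ρ = fs (t.realize ρ) := by
  simp only [fs, fstTm, sndTm, realize_ap2, realize_ap1, realize_v]

theorem realize_sndTm (t : Tm) (ρ : ℕ → M) : (sndTm t).realize ρ = sn (t.realize ρ) := by
  simp only [sn, sndTm, realize_ap2, realize_ap1, realize_v]

theorem realize_pairTm (t s : Tm) (ρ : ℕ → M) :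
    (pairTm t s).realize ρ = pr (t.realize ρ) (s.realize ρ) := by
  simp only [pr, pairTm, realize_ap2, realize_ap1, realize_v, scons_zero, scons_one]

theorem realize_entryTm (t s : Tm) (ρ : ℕ → M) :
    (entryTm t s).realize ρ = entry (t.realize ρ) (s.realize ρ) := by
  simp only [entryTm, realize_fstTm, realize_ap2, entry]

/-! ### Consequences of the axioms -/

variable [IsPA M]

theorem ev_codeOf {n : ℕ} (t : Tm) (xs : Fin n → M) :
    ev (codeOf n t) xs = t.realize (envOf xs) := by
  have hc : ∀ {m : ℕ} (f : PRCode m) (g : Fin m → PRCode n),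
      ev (.comp f g) xs = ev f fun i => ev (g i) xs := by
    intro m f g
    have := IsPA.sat_ax _ (.compEq f g) (envOf xs)
    simpa only [sat, realize_app, realize_v, envOf_fin] using this
  induction t with
  | var i =>
    simp only [codeOf, Term.realize, envOf]
    split_ifs with h
    · have := IsPA.sat_ax _ (.projEq (⟨i, h⟩ : Fin n)) (envOf xs)
      simp only [sat, realize_app, realize_v, envOf_fin] at this
      rw [this]; simp [envOf, h]
    · rw [hc, zr]; congr 1; funext i; exact i.elim0
  | func f ts ih =>
    exact (hc f _).trans (by simp only [ih]; rfl)

theorem ev_recCode_zero {n : ℕ} (b g : Tm) (xs : Fin n → M) :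
    ev (recCode n b g) (Fin.cons zr xs) = b.realize (envOf xs) := by
  have := IsPA.sat_ax _ (.precZero (codeOf n b) (codeOf (n + 2) g)) (envOf xs)
  simp only [sat, realize_app, realize_cons, realize_v, envOf_fin, realize_zeroTm] at this
  rw [recCode, this, ev_codeOf]

theorem ev_recCode_succ {n : ℕ} (b g : Tm) (y : M) (xs : Fin n → M) :
    ev (recCode n b g) (Fin.cons (sc y) xs) =
      g.realize (scons y (scons (ev (recCode n b g) (Fin.cons y xs)) (envOf xs))) := by
  have := IsPA.sat_ax _ (.precSucc (codeOf n b) (codeOf (n + 2) g)) (scons y (envOf xs))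
  simp only [sat, realize_app, realize_cons, realize_v, envOf_fin, realize_succTm, scons_zero,
    scons_succ] at this
  rw [recCode, this, ev_codeOf, envOf_cons, envOf_cons]

theorem sc_ne_zr (x : M) : sc x ≠ zr := by
  have := IsPA.sat_ax _ .succNeZero (fun _ => x)
  simpa only [sat_neg, sat, realize_succTm, realize_zeroTm, realize_v] using this

theorem sc_inj {x y : M} (h : sc x = sc y) : x = y := by
  have := IsPA.sat_ax _ .succInj (scons x fun _ => y)
  simp only [sat, realize_succTm, realize_v] at this
  exact this h

/-- Induction for definable properties. -/
theorem IsPA.ind {S : M → Prop} (φ : Formula) (ρ : ℕ → M) (h : ∀ m, sat (scons m ρ) φ ↔ S m)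
    (h0 : S zr) (hs : ∀ m, S m → S (sc m)) (m : M) : S m := by
  have := IsPA.sat_ax _ (.induction φ) ρ
  simp only [sat, sat_inst, realize_zeroTm, h, sat_subst] at this
  refine this h0 (fun x hx => ?_) m
  convert (h (sc x)).2 (hs x hx) using 2 with i
  cases i <;> rfl

theorem add_zr_left (a : M) : op2 addC zr a = a := by
  rw [op2, addC, ev_recCode_zero, envOf_cons]; rfl

theorem add_sc_left (a b : M) : op2 addC (sc a) b = sc (op2 addC a b) := by
  rw [op2, addC, ev_recCode_succ]; rfl

theorem pred_sc (a : M) : op1 predC (sc a) = a := by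
  rw [op1, predC, ev_recCode_succ]; rfl

theorem sub_zr (a : M) : op2 subC zr a = a := by
  rw [op2, subC, ev_recCode_zero, envOf_cons]; rfl

theorem sub_sc (a b : M) : op2 subC (sc a) b = op1 predC (op2 subC a b) := by
  rw [op2, subC, ev_recCode_succ, realize_ap1]; rfl

theorem ite_zr (a b : M) : op3 iteC zr a b = a := by
  rw [op3, iteC, ev_recCode_zero, envOf_cons]; rfl

theorem ite_sc (c a b : M) : op3 iteC (sc c) a b = b := by
  rw [op3, iteC, ev_recCode_succ, envOf_cons, envOf_cons]; rfl

theorem tri_zr : op1 triC (zr : M) = zr := by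
  rw [op1, triC, ev_recCode_zero, realize_zeroTm]

theorem tri_sc (a : M) : op1 triC (sc a) = op2 addC (sc a) (op1 triC a) := by
  rw [op1, triC, ev_recCode_succ, realize_ap2]; rfl

theorem tail_zr (s : M) : op2 tailC zr s = s := by
  rw [op2, tailC, ev_recCode_zero, envOf_cons]; rfl

theorem tail_sc (d s : M) : op2 tailC (sc d) s = (sndTm (v 0)).realize fun _ => op2 tailC d s := by
  rw [op2, tailC, ev_recCode_succ]
  simp only [sndTm, realize_ap1, realize_ap2, realize_v, scons_one, scons_zero]; rfl

theorem zr_or_sc (x : M) : x = zr ∨ ∃ y, x = sc y := by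
  refine IsPA.ind (S := fun x => x = zr ∨ ∃ y, x = sc y)
    (or (eq (v 0) zeroTm) (ex (eq (v 1) (succTm (v 0))))) (fun _ => zr) (fun m => ?_)
    (.inl rfl) (fun m _ => .inr ⟨m, rfl⟩) x
  simp [sat, realize_v, realize_zeroTm, realize_succTm]

theorem add_zr (a : M) : op2 addC a zr = a := by
  refine IsPA.ind (S := fun a => op2 addC a zr = a) (eq (ap2 addC (v 0) zeroTm) (v 0))
    (fun _ => zr) (fun m => ?_) (add_zr_left _) (fun m h => ?_) a
  · simp [sat, realize_v, realize_zeroTm, realize_ap2]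
  · simp only [add_sc_left, h]

theorem add_sc (a b : M) : op2 addC a (sc b) = sc (op2 addC a b) := by
  refine IsPA.ind (S := fun a => op2 addC a (sc b) = sc (op2 addC a b))
    (eq (ap2 addC (v 0) (succTm (v 1))) (succTm (ap2 addC (v 0) (v 1))))
    (fun _ => b) (fun m => ?_) ?_ (fun m h => ?_) a
  · simp [sat, realize_v, realize_succTm, realize_ap2]
  · simp only [add_zr_left]
  · simp only [add_sc_left, h]

theorem add_comm' (a b : M) : op2 addC a b = op2 addC b a := by
  refine IsPA.ind (S := fun a => op2 addC a b = op2 addC b a)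
    (eq (ap2 addC (v 0) (v 1)) (ap2 addC (v 1) (v 0)))
    (fun _ => b) (fun m => ?_) ?_ (fun m h => ?_) a
  · simp [sat, realize_v, realize_ap2]
  · simp only [add_zr_left, add_zr]
  · simp only [add_sc_left, add_sc, h]

theorem add_left_cancel' {a b c : M} (h : op2 addC a b = op2 addC a c) : b = c := by
  refine IsPA.ind (S := fun a => op2 addC a b = op2 addC a c → b = c)
    (imp (eq (ap2 addC (v 0) (v 1)) (ap2 addC (v 0) (v 2))) (eq (v 1) (v 2)))
    (scons b fun _ => c) (fun m => ?_) ?_ (fun m h => ?_) a h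
  · simp [sat, realize_v, realize_ap2]
  · simp only [add_zr_left, imp_self]
  · simp only [add_sc_left]; exact fun h' => h (sc_inj h')

theorem add_eq_zr {a b : M} : op2 addC a b = zr ↔ a = zr ∧ b = zr := by
  rcases zr_or_sc a with rfl | ⟨a, rfl⟩
  · simp [add_zr_left]
  · simp [add_sc_left, sc_ne_zr]

theorem sub_sc_sc (a b : M) : op2 subC (sc a) (sc b) = op2 subC a b := by
  refine IsPA.ind (S := fun a => op2 subC (sc a) (sc b) = op2 subC a b)
    (eq (ap2 subC (succTm (v 0)) (succTm (v 1))) (ap2 subC (v 0) (v 1)))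
    (fun _ => b) (fun m => ?_) ?_ (fun m h => ?_) a
  · simp [sat, realize_v, realize_ap2, realize_succTm]
  · simp only [sub_sc, sub_zr, pred_sc]
  · rw [sub_sc, h, sub_sc m b]

theorem sub_add (a b : M) : op2 subC a (op2 addC a b) = b := by
  refine IsPA.ind (S := fun a => op2 subC a (op2 addC a b) = b)
    (eq (ap2 subC (v 0) (ap2 addC (v 0) (v 1))) (v 1))
    (fun _ => b) (fun m => ?_) ?_ (fun m h => ?_) a
  · simp [sat, realize_v, realize_ap2]
  · simp only [sub_zr, add_zr_left]
  · simp only [add_sc_left, sub_sc_sc, h]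

theorem sub_self' (a : M) : op2 subC a a = zr := by
  simpa only [add_zr] using sub_add a zr

theorem realize_distTm (t s : Tm) (ρ : ℕ → M) :
    (distTm t s).realize ρ = zr ↔ t.realize ρ = s.realize ρ := by
  simp only [distTm, realize_ap2, add_eq_zr]
  generalize t.realize ρ = a
  generalize s.realize ρ = b
  constructor
  · refine IsPA.ind (S := fun a => ∀ b, op2 subC a b = zr ∧ op2 subC b a = zr → a = b)
      (all (imp (and (eq (ap2 subC (v 1) (v 0)) zeroTm) (eq (ap2 subC (v 0) (v 1)) zeroTm))
        (eq (v 1) (v 0)))) (fun _ => zr) (fun m => ?_) ?_ (fun m ih => ?_) a b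
    · simp [sat, realize_v, realize_ap2, realize_zeroTm]
    · intro b hb
      rw [sub_zr] at hb
      exact hb.1.symm
    · intro b hb
      rcases zr_or_sc b with rfl | ⟨b, rfl⟩
      · rw [sub_zr] at hb
        exact hb.2
      · rw [sub_sc_sc, sub_sc_sc] at hb
        rw [ih b hb]
  · rintro rfl
    exact ⟨sub_self' a, sub_self' a⟩

-- Correctness of the Cantor pairing and of sequence coding

theorem diag_zr : op1 diagC (zr : M) = zr := by
  rw [op1, diagC, ev_recCode_zero, realize_zeroTm]

theorem diag_sc_of_eq {a : M} (h : sc a = op1 triC (sc (op1 diagC a))) :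
    op1 diagC (sc a) = sc (op1 diagC a) := by
  rw [op1, diagC, ev_recCode_succ, ← diagC, realize_ap3, (realize_distTm _ _ _).2, ite_zr]
  · rfl
  · simp only [realize_succTm, realize_ap1]; exact h

theorem diag_sc_of_ne {a : M} (h : sc a ≠ op1 triC (sc (op1 diagC a))) :
    op1 diagC (sc a) = op1 diagC a := by
  rw [op1, diagC, ev_recCode_succ, ← diagC, realize_ap3]
  have h' := mt (realize_distTm (M := M) (succTm (v 0)) (ap1 triC (succTm (v 1)))
    (scons a (scons (ev diagC (Fin.cons a Fin.elim0)) (envOf Fin.elim0)))).1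
    (by simp only [realize_succTm, realize_ap1]; exact h)
  obtain ⟨y, hy⟩ := (zr_or_sc _).resolve_left h'
  rw [hy, ite_sc]; rfl

/-- The code of position `j` on diagonal `m = j + a` is `j` plus the `m`-th triangular number. The
proof is an induction on `m` and, within it, on `j`: the diagonal index increases exactly when a
code reaches the next triangular number. -/
theorem diag_pair (j a : M) :
    op1 diagC (op2 addC j (op1 triC (op2 addC j a))) = op2 addC j a := by
  have key : ∀ m j a : M, op2 addC j a = m → op1 diagC (op2 addC j (op1 triC m)) = m := by
    intro m
    refine IsPA.ind (S := fun m => ∀ j a : M, op2 addC j a = m →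
        op1 diagC (op2 addC j (op1 triC m)) = m)
      (all (all (imp (eq (ap2 addC (v 1) (v 0)) (v 2))
        (eq (ap1 diagC (ap2 addC (v 1) (ap1 triC (v 2)))) (v 2))))) (fun _ => zr)
      (fun m => ?_) ?_ (fun m ih => ?_) m
    · simp [sat, realize_v, realize_ap2, realize_ap1]
    · intro j a h
      rw [add_eq_zr] at h
      rw [h.1, tri_zr, add_zr, diag_zr]
    · intro j
      refine IsPA.ind (S := fun j => ∀ a : M, op2 addC j a = sc m →
          op1 diagC (op2 addC j (op1 triC (sc m))) = sc m)
        (all (imp (eq (ap2 addC (v 1) (v 0)) (succTm (v 2)))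
          (eq (ap1 diagC (ap2 addC (v 1) (ap1 triC (succTm (v 2))))) (succTm (v 2))))) (fun _ => m)
        (fun m => ?_) ?_ (fun j ih' => ?_) j
      · simp [sat, realize_v, realize_ap2, realize_ap1, realize_succTm]
      · intro a _
        -- Position zero of a diagonal comes right after the last position, `m`, of the diagonal
        -- `m`.
        have h₁ := ih m zr (add_zr m)
        rw [add_zr_left, tri_sc, add_sc_left, diag_sc_of_eq, h₁]
        rw [h₁, tri_sc, add_sc_left]
      · intro a ha
        have h₁ := ih' (sc a) (by rw [add_sc, ← add_sc_left, ha])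
        rw [add_sc_left, diag_sc_of_ne, h₁]
        rw [h₁, tri_sc (sc m), add_sc_left]
        -- Reaching the next triangular number here would mean `j = m + 1`, whereas `j + (a + 1) = m
        -- + 1`.
        intro h₂
        have h₃ := sc_inj h₂
        rw [add_comm' j, add_comm' (sc m)] at h₃
        have h₄ := add_left_cancel' h₃
        rw [← ha, add_sc_left, ← add_sc] at h₄
        have h₅ := add_left_cancel' (h₄.symm.trans (add_zr j).symm)
        exact sc_ne_zr _ h₅
  exact key _ j a rfl

theorem realize_snd_pair (t s : Tm) (ρ : ℕ → M) :
    (sndTm (pairTm t s)).realize ρ = s.realize ρ := by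
  simp only [sndTm, pairTm, realize_ap2, realize_ap1, diag_pair]
  rw [add_comm' (s.realize ρ) (op1 triC _), sub_add]

theorem realize_fst_pair (t s : Tm) (ρ : ℕ → M) :
    (fstTm (pairTm t s)).realize ρ = t.realize ρ := by
  have h := realize_snd_pair t s ρ
  rw [fstTm, realize_ap2, h]
  simp only [pairTm, realize_ap2, realize_ap1, diag_pair, sub_add]

theorem fs_pr (a b : M) : fs (pr a b) = a := by
  have := realize_fst_pair (v 0) (v 1) (scons a fun _ => b)
  rwa [realize_fstTm, realize_pairTm] at this

theorem sn_pr (a b : M) : sn (pr a b) = b := by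
  have := realize_snd_pair (v 0) (v 1) (scons a fun _ => b)
  rwa [realize_sndTm, realize_pairTm] at this

theorem entry_zr (a s : M) : entry zr (pr a s) = a := by
  rw [entry, tail_zr, fs_pr]

/-- The recursion for `tailC` applies the projection last, whereas the head has to be dropped first;
an induction on `d` commutes the two. -/
theorem entry_sc (d a s : M) : entry (sc d) (pr a s) = entry d s := by
  have : op2 tailC (sc d) (pr a s) = op2 tailC d s := by
    refine IsPA.ind (S := fun d => op2 tailC (sc d) (pr a s) = op2 tailC d s)
      (eq (ap2 tailC (succTm (v 0)) (pairTm (v 1) (v 2))) (ap2 tailC (v 0) (v 2)))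
      (scons a fun _ => s) (fun m => ?_) ?_ (fun m h => ?_) d
    · simp [sat, realize_v, realize_ap2, realize_succTm, realize_pairTm]
    · rw [tail_sc, tail_zr, tail_zr]; exact sn_pr a s
    · rw [tail_sc, h, tail_sc]
  rw [entry, this, entry]

/-! ### Order -/

/-- The order of a model. -/
def Less (x y : M) : Prop := ∃ d, y = sc (op2 addC d x)

theorem not_less_zr (x : M) : ¬ Less x zr := fun ⟨_, h⟩ => sc_ne_zr _ h.symm

theorem less_sc {x y : M} : Less x (sc y) ↔ Less x y ∨ x = y := by
  constructor
  · rintro ⟨d, hd⟩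
    have h := sc_inj hd
    rcases zr_or_sc d with rfl | ⟨d, rfl⟩
    · exact .inr (by rw [h, add_zr_left])
    · exact .inl ⟨d, by rw [h, add_sc_left]⟩
  · rintro (⟨d, hd⟩ | rfl)
    · exact ⟨sc d, by rw [hd, add_sc_left]⟩
    · exact ⟨zr, by rw [add_zr_left]⟩

theorem less_trichotomy (x y : M) : Less x y ∨ x = y ∨ Less y x := by
  have hz : ∀ x : M, Less zr (sc x) := fun x => ⟨x, by rw [add_zr]⟩
  have hs : ∀ {x y : M}, Less x y → Less (sc x) (sc y) :=
    fun ⟨d, hd⟩ => ⟨d, by rw [hd, add_sc]⟩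
  refine IsPA.ind (S := fun x => ∀ y, Less x y ∨ x = y ∨ Less y x)
    (all (or (ex (eq (v 1) (succTm (ap2 addC (v 0) (v 2))))) (or (eq (v 1) (v 0))
      (ex (eq (v 2) (succTm (ap2 addC (v 0) (v 1)))))))) (fun _ => zr)
    (fun m => ?_) (fun y => ?_) (fun x ih y => ?_) x y
  · simp [sat, realize_v, realize_ap2, realize_succTm, Less]
  · rcases zr_or_sc y with rfl | ⟨y, rfl⟩
    · exact .inr (.inl rfl)
    · exact .inl (hz y)
  · rcases zr_or_sc y with rfl | ⟨y, rfl⟩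
    · exact .inr (.inr (hz x))
    · rcases ih y with h | rfl | h
      · exact .inl (hs h)
      · exact .inr (.inl rfl)
      · exact .inr (.inr (hs h))

/-- Sequences of length `x` grow at the front, so the entry for `y < x` has index `x - (y + 1)`;
lengthening the sequence raises this index by one. -/
theorem sub_of_less {x y : M} (h : Less y x) :
    op2 subC (sc y) (sc x) = sc (op2 subC (sc y) x) := by
  obtain ⟨d, rfl⟩ := h
  rw [sub_sc_sc, sub_sc_sc, ← add_sc_left, add_comm', sub_add, add_comm', sub_add]

end PA

/-! ### Bounded quantification -/

/-- The formula `∀ y < x, φ (y)`, where `x` and `y` are the variable `0`. -/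
def ball (φ : Formula) : Formula :=
  all (all (imp (eq (v 2) (succTm (ap2 addC (v 0) (v 1))))
    (φ.subst (scons (v 1) fun i => v (i + 3)))))

theorem sat_ball {M : Type} [arith.Structure M] (φ : Formula) (x : M) (ρ : ℕ → M) :
    sat (scons x ρ) (ball φ) ↔ ∀ y, Less y x → sat (scons y ρ) φ := by
  simp only [ball, sat, sat_subst, realize_succTm, realize_ap2, realize_scons, realize_v,
    scons_succ, scons_zero, Less]
  exact ⟨fun h y ⟨d, hd⟩ => h y d hd, fun h y d hd => h y ⟨d, hd⟩⟩

/-- A term that vanishes if and only if the quantifier-free formula holds. -/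
def charTm : Formula → Tm
  | .falsum => succTm zeroTm
  | .eq t s => distTm t s
  | .and φ ψ => ap3 iteC (charTm φ) (charTm ψ) (succTm zeroTm)
  | .or φ ψ => ap3 iteC (charTm φ) zeroTm (charTm ψ)
  | .imp φ ψ => ap3 iteC (charTm φ) (charTm ψ) zeroTm
  | .all _ => zeroTm
  | .ex _ => zeroTm

theorem realize_charTm {M : Type} [arith.Structure M] [IsPA M] {φ : Formula}
    (hφ : φ.QuantifierFree) (ρ : ℕ → M) : (charTm φ).realize ρ = zr ↔ sat ρ φ := by
  induction φ with
  | falsum => simp [charTm, sat, realize_succTm, sc_ne_zr]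
  | eq t s => exact realize_distTm t s ρ
  | and φ ψ h₁ h₂ =>
    rw [charTm, sat, ← h₁ hφ.1, ← h₂ hφ.2, realize_ap3]
    rcases zr_or_sc ((charTm φ).realize ρ) with h | ⟨y, h⟩
    · rw [h, ite_zr]; simp
    · rw [h, ite_sc]; simp [sc_ne_zr, realize_succTm]
  | or φ ψ h₁ h₂ =>
    rw [charTm, sat, ← h₁ hφ.1, ← h₂ hφ.2, realize_ap3]
    rcases zr_or_sc ((charTm φ).realize ρ) with h | ⟨y, h⟩
    · rw [h, ite_zr]; simp [realize_zeroTm]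
    · rw [h, ite_sc]; simp [sc_ne_zr]
  | imp φ ψ h₁ h₂ =>
    rw [charTm, sat, ← h₁ hφ.1, ← h₂ hφ.2, realize_ap3]
    rcases zr_or_sc ((charTm φ).realize ρ) with h | ⟨y, h⟩
    · rw [h, ite_zr]; simp
    · rw [h, ite_sc]; simp [sc_ne_zr, realize_zeroTm]
  | all φ h => exact hφ.elim
  | ex φ h => exact hφ.elim

/-- Terms are closed under primitive recursion. -/
theorem exists_rec (b g : Tm) : ∃ r : Tm, ∀ (M : Type) [arith.Structure M] [IsPA M] (ρ : ℕ → M),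
    r.realize (scons zr ρ) = b.realize ρ ∧ ∀ y, r.realize (scons (sc y) ρ) =
      g.realize (scons y (scons (r.realize (scons y ρ)) ρ)) := by
  -- All variables of `b` and `g` lie below `n`, so filling the assignment with zeros from there on
  -- does not change their values.
  let n := max (b.varFinset.sup Nat.succ) (g.varFinset.sup Nat.succ)
  refine ⟨app (recCode n b g) fun j => v j, fun M _ _ ρ => ?_⟩
  have he : ∀ i < n, envOf (fun j : Fin n => ρ j) i = ρ i := fun i hi => by simp [envOf, hi]
  simp only [realize_app, realize_v, scons_fin, ev_recCode_zero, ev_recCode_succ]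
  refine ⟨realize_congr b fun i hi => he i (lt_max_of_lt_left hi), fun y =>
    realize_congr g fun i hi => ?_⟩
  rcases i with - | - | i
  · rfl
  · rfl
  · exact he i (lt_of_le_of_lt (by omega) (lt_max_of_lt_right hi))

/-- Zero codes truth. The characteristic term of the bounded formula is defined by primitive
recursion: it stays zero as long as the characteristic term of `φ` vanishes, and is one from the
first failure on. -/
theorem exists_quantifierFree_ball {φ : Formula} (hφ : φ.QuantifierFree) :
    ∃ ψ : Formula, ψ.QuantifierFree ∧ ∀ (M : Type) [arith.Structure M] [IsPA M] (ρ : ℕ → M),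
      sat ρ ψ ↔ sat ρ (ball φ) := by
  obtain ⟨r, hr⟩ := exists_rec zeroTm (ap3 iteC (v 1)
    -- In the recursion step variable `1` is the previous value, so the parameters of `φ` move up
    -- past it.
    ((charTm φ).subst (scons (v 0) fun i => v (i + 2))) (succTm zeroTm))
  refine ⟨eq r zeroTm, trivial, fun M _ _ ρ => ?_⟩
  rw [← scons_eta ρ, sat_ball, sat, realize_zeroTm]
  generalize ρ 0 = x
  generalize (fun i => ρ (i + 1)) = ρ
  obtain ⟨h0, hs⟩ := hr M ρ
  refine IsPA.ind (S := fun x => r.realize (scons x ρ) = zr ↔ ∀ y, Less y x → sat (scons y ρ) φ)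
    (iff (eq r zeroTm) (ball φ)) ρ (fun x => ?_) ?_ (fun x ih => ?_) x
  · simp only [iff, sat, sat_ball, realize_zeroTm, iff_def]
  · simp [h0, realize_zeroTm, not_less_zr]
  · simp only [hs, less_sc, realize_ap3, Term.realize_subst, realize_scons, realize_v, scons_zero,
      scons_succ]
    rcases zr_or_sc (r.realize (scons x ρ)) with h | ⟨y, h⟩
    · rw [h, ite_zr, realize_charTm hφ]
      have := ih.1 h
      exact ⟨fun h' y hy => hy.elim (this y) fun e => e ▸ h', fun h' => h' x (.inr rfl)⟩
    · rw [h, ite_sc]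
      simp only [realize_succTm, sc_ne_zr, false_iff]
      intro h'
      have := ih.2 fun y hy => h' y (.inl hy)
      exact sc_ne_zr _ (h.symm.trans this)

/-! ### The arithmetical hierarchy up to an equivalence -/

theorem mem_sigmaNat_succ {k : ℕ} {φ : Formula} :
    φ ∈ sigmaNat (k + 1) ↔ ∃ n ≥ 1, ∃ ψ ∈ piNat k, φ = ex^[n] ψ := by rw [sigmaNat]; rfl

theorem mem_piNat_succ {k : ℕ} {φ : Formula} :
    φ ∈ piNat (k + 1) ↔ ∃ n ≥ 1, ∃ ψ ∈ sigmaNat k, φ = all^[n] ψ := by rw [piNat]; rfl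

theorem mem_sigmaNat_zero {φ : Formula} : φ ∈ sigmaNat 0 ↔ φ.QuantifierFree := by
  rw [sigmaNat]; rfl

theorem mem_piNat_zero {φ : Formula} : φ ∈ piNat 0 ↔ φ.QuantifierFree := by rw [piNat]; rfl

theorem quantifierFree_subst {φ : Formula} (h : φ.QuantifierFree) (σ : ℕ → Tm) :
    (φ.subst σ).QuantifierFree := by
  induction φ generalizing σ <;> simp_all [Formula.subst, QuantifierFree]

theorem ex_iterate_subst (n : ℕ) (φ : Formula) (σ : ℕ → Tm) :
    (ex^[n] φ).subst σ = ex^[n] (φ.subst (liftSubst^[n] σ)) := by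
  induction n generalizing φ σ with
  | zero => rfl
  | succ n ih =>
    rw [Function.iterate_succ_apply', Function.iterate_succ_apply', Formula.subst, ih,
      Function.iterate_succ_apply]

theorem all_iterate_subst (n : ℕ) (φ : Formula) (σ : ℕ → Tm) :
    (all^[n] φ).subst σ = all^[n] (φ.subst (liftSubst^[n] σ)) := by
  induction n generalizing φ σ with
  | zero => rfl
  | succ n ih =>
    rw [Function.iterate_succ_apply', Function.iterate_succ_apply', Formula.subst, ih,
      Function.iterate_succ_apply]

theorem hierarchy_subst (k : ℕ) :
    (∀ φ ∈ sigmaNat k, ∀ σ, φ.subst σ ∈ sigmaNat k) ∧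
      ∀ φ ∈ piNat k, ∀ σ, φ.subst σ ∈ piNat k := by
  induction k with
  | zero =>
    simp only [mem_sigmaNat_zero, mem_piNat_zero, and_self]
    exact fun φ h σ => quantifierFree_subst h σ
  | succ k ih =>
    simp only [mem_sigmaNat_succ, mem_piNat_succ]
    constructor
    · rintro _ ⟨n, hn, ψ, hψ, rfl⟩ σ
      exact ⟨n, hn, _, ih.2 ψ hψ _, ex_iterate_subst n ψ σ⟩
    · rintro _ ⟨n, hn, ψ, hψ, rfl⟩ σ
      exact ⟨n, hn, _, ih.1 ψ hψ _, all_iterate_subst n ψ σ⟩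

theorem sigmaNat_subst {k : ℕ} {φ : Formula} (h : φ ∈ sigmaNat k) (σ : ℕ → Tm) :
    φ.subst σ ∈ sigmaNat k := (hierarchy_subst k).1 φ h σ

theorem piNat_subst {k : ℕ} {φ : Formula} (h : φ ∈ piNat k) (σ : ℕ → Tm) :
    φ.subst σ ∈ piNat k := (hierarchy_subst k).2 φ h σ

theorem ex_mem_sigmaNat {k : ℕ} {φ : Formula} (h : φ ∈ piNat k) : ex φ ∈ sigmaNat (k + 1) :=
  mem_sigmaNat_succ.2 ⟨1, le_rfl, φ, h, rfl⟩

theorem all_mem_piNat {k : ℕ} {φ : Formula} (h : φ ∈ sigmaNat k) : all φ ∈ piNat (k + 1) :=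
  mem_piNat_succ.2 ⟨1, le_rfl, φ, h, rfl⟩

theorem ex_mem_sigmaNat_succ {k : ℕ} {φ : Formula} (h : φ ∈ sigmaNat (k + 1)) :
    ex φ ∈ sigmaNat (k + 1) := by
  obtain ⟨n, hn, ψ, hψ, rfl⟩ := mem_sigmaNat_succ.1 h
  exact mem_sigmaNat_succ.2 ⟨n + 1, by omega, ψ, hψ, (Function.iterate_succ_apply' ex n ψ).symm⟩

theorem all_mem_piNat_succ {k : ℕ} {φ : Formula} (h : φ ∈ piNat (k + 1)) :
    all φ ∈ piNat (k + 1) := by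
  obtain ⟨n, hn, ψ, hψ, rfl⟩ := mem_piNat_succ.1 h
  exact mem_piNat_succ.2 ⟨n + 1, by omega, ψ, hψ, (Function.iterate_succ_apply' all n ψ).symm⟩

/-- `Σ_{k+1}` is generated from `Π_k` by existential quantification. -/
theorem sigmaNat_succ_induction {k : ℕ} {P : Formula → Prop} (h₁ : ∀ φ ∈ piNat k, P (ex φ))
    (h₂ : ∀ φ ∈ sigmaNat (k + 1), P φ → P (ex φ)) {φ : Formula} (h : φ ∈ sigmaNat (k + 1)) :
    P φ := by
  obtain ⟨n, hn, ψ, hψ, rfl⟩ := mem_sigmaNat_succ.1 h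
  clear h
  induction n, hn using Nat.le_induction with
  | base => exact h₁ ψ hψ
  | succ n hn ih =>
    rw [Function.iterate_succ_apply']
    exact h₂ _ (mem_sigmaNat_succ.2 ⟨n, hn, ψ, hψ, rfl⟩) ih

/-- `Π_{k+1}` is generated from `Σ_k` by universal quantification. -/
theorem piNat_succ_induction {k : ℕ} {P : Formula → Prop} (h₁ : ∀ φ ∈ sigmaNat k, P (all φ))
    (h₂ : ∀ φ ∈ piNat (k + 1), P φ → P (all φ)) {φ : Formula} (h : φ ∈ piNat (k + 1)) :
    P φ := by
  obtain ⟨n, hn, ψ, hψ, rfl⟩ := mem_piNat_succ.1 h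
  clear h
  induction n, hn using Nat.le_induction with
  | base => exact h₁ ψ hψ
  | succ n hn ih =>
    rw [Function.iterate_succ_apply']
    exact h₂ _ (mem_piNat_succ.2 ⟨n, hn, ψ, hψ, rfl⟩) ih

/-- Equivalences of formulas that respect quantifiers and the addition of dummy quantifiers. -/
structure QuantCongr (E : Formula → Formula → Prop) : Prop where
  refl : ∀ φ, E φ φ
  trans : ∀ {φ ψ χ}, E φ ψ → E ψ χ → E φ χ
  ex : ∀ {φ ψ}, E φ ψ → E (ex φ) (ex ψ)
  all : ∀ {φ ψ}, E φ ψ → E (all φ) (all ψ)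
  dummy_ex : ∀ φ, E (Formula.ex φ.shift) φ
  dummy_all : ∀ φ, E (Formula.all φ.shift) φ

/-- The formulas related to a `Σ_k` formula. -/
def IsSigma (E : Formula → Formula → Prop) (k : ℕ) (φ : Formula) : Prop :=
  ∃ ψ ∈ sigmaNat k, E ψ φ

/-- The formulas related to a `Π_k` formula. -/
def IsPi (E : Formula → Formula → Prop) (k : ℕ) (φ : Formula) : Prop :=
  ∃ ψ ∈ piNat k, E ψ φ

namespace QuantCongr

variable {E : Formula → Formula → Prop} (hE : QuantCongr E) {k : ℕ} {φ ψ : Formula}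

include hE

theorem isSigma_congr (h : IsSigma E k φ) (h' : E φ ψ) : IsSigma E k ψ :=
  let ⟨χ, hχ, e⟩ := h; ⟨χ, hχ, hE.trans e h'⟩

theorem isPi_congr (h : IsPi E k φ) (h' : E φ ψ) : IsPi E k ψ :=
  let ⟨χ, hχ, e⟩ := h; ⟨χ, hχ, hE.trans e h'⟩

theorem isSigma_ex (h : IsPi E k φ) : IsSigma E (k + 1) (Formula.ex φ) :=
  let ⟨_, hχ, e⟩ := h; ⟨_, ex_mem_sigmaNat hχ, hE.ex e⟩

theorem isPi_all (h : IsSigma E k φ) : IsPi E (k + 1) (Formula.all φ) :=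
  let ⟨_, hχ, e⟩ := h; ⟨_, all_mem_piNat hχ, hE.all e⟩

theorem isSigma_ex_succ (h : IsSigma E (k + 1) φ) : IsSigma E (k + 1) (Formula.ex φ) :=
  let ⟨_, hχ, e⟩ := h; ⟨_, ex_mem_sigmaNat_succ hχ, hE.ex e⟩

theorem isPi_all_succ (h : IsPi E (k + 1) φ) : IsPi E (k + 1) (Formula.all φ) :=
  let ⟨_, hχ, e⟩ := h; ⟨_, all_mem_piNat_succ hχ, hE.all e⟩

theorem isSigma_of_isPi (h : IsPi E k φ) : IsSigma E (k + 1) φ :=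
  let ⟨χ, hχ, e⟩ := h
  ⟨_, ex_mem_sigmaNat (piNat_subst hχ _), hE.trans (hE.dummy_ex χ) e⟩

theorem isPi_of_isSigma (h : IsSigma E k φ) : IsPi E (k + 1) φ :=
  let ⟨χ, hχ, e⟩ := h
  ⟨_, all_mem_piNat (sigmaNat_subst hχ _), hE.trans (hE.dummy_all χ) e⟩

/-- The classes are not literally cumulative. A dummy quantifier is inserted at the innermost level,
and the existing prefix is kept above it. -/
theorem isSigma_succ_and_isPi_succ (k : ℕ) :
    (∀ φ ∈ sigmaNat k, IsSigma E (k + 1) φ) ∧ ∀ φ ∈ piNat k, IsPi E (k + 1) φ := by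
  induction k with
  | zero =>
    refine ⟨fun φ h => hE.isSigma_of_isPi ⟨φ, ?_, hE.refl φ⟩,
      fun φ h => hE.isPi_of_isSigma ⟨φ, ?_, hE.refl φ⟩⟩
    · rwa [mem_piNat_zero, ← mem_sigmaNat_zero]
    · rwa [mem_sigmaNat_zero, ← mem_piNat_zero]
  | succ k ih =>
    exact ⟨fun φ h => sigmaNat_succ_induction (fun φ h => hE.isSigma_ex (ih.2 φ h))
      (fun φ _ h => hE.isSigma_ex_succ h) h,
      fun φ h => piNat_succ_induction (fun φ h => hE.isPi_all (ih.1 φ h))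
      (fun φ _ h => hE.isPi_all_succ h) h⟩

theorem isSigma_succ (h : IsSigma E k φ) : IsSigma E (k + 1) φ :=
  let ⟨χ, hχ, e⟩ := h; hE.isSigma_congr ((hE.isSigma_succ_and_isPi_succ k).1 χ hχ) e

theorem isPi_succ (h : IsPi E k φ) : IsPi E (k + 1) φ :=
  let ⟨χ, hχ, e⟩ := h; hE.isPi_congr ((hE.isSigma_succ_and_isPi_succ k).2 χ hχ) e

theorem isSigma_mono {l : ℕ} (hkl : k ≤ l) (h : IsSigma E k φ) : IsSigma E l φ := by
  induction l, hkl using Nat.le_induction with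
  | base => exact h
  | succ l _ ih => exact hE.isSigma_succ ih

end QuantCongr

/-- The substitution that replaces the variables `0` and `1` by the components of the
variable `0`. -/
def unpairSubst : ℕ → Tm :=
  scons (sndTm (v 0)) (scons (fstTm (v 0)) fun i => v (i + 1))

/-- Contraction of a block of existential quantifiers. -/
theorem QuantCongr.exists_ex {E : Formula → Formula → Prop} (hE : QuantCongr E) {k : ℕ}
    (hc : ∀ φ ∈ piNat k, E (Formula.ex (φ.subst unpairSubst)) (Formula.ex (Formula.ex φ)))
    {φ : Formula} (h : IsSigma E (k + 1) φ) : ∃ ψ ∈ piNat k, E (Formula.ex ψ) φ := by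
  obtain ⟨χ, hχ, e⟩ := h
  suffices ∃ ψ ∈ piNat k, E (Formula.ex ψ) χ from
    this.imp fun ψ hψ => ⟨hψ.1, hE.trans hψ.2 e⟩
  refine sigmaNat_succ_induction (P := fun χ => ∃ ψ ∈ piNat k, E (Formula.ex ψ) χ)
    (fun ψ hψ => ⟨ψ, hψ, hE.refl _⟩) (fun φ _ ⟨ψ, hψ, e⟩ => ?_) hχ
  exact ⟨_, piNat_subst hψ _, hE.trans (hc ψ hψ) (hE.ex e)⟩

/-- Contraction of a block of universal quantifiers. -/
theorem QuantCongr.exists_all {E : Formula → Formula → Prop} (hE : QuantCongr E) {k : ℕ}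
    (hc : ∀ φ ∈ sigmaNat k, E (Formula.all (φ.subst unpairSubst)) (Formula.all (Formula.all φ)))
    {φ : Formula} (h : IsPi E (k + 1) φ) : ∃ ψ ∈ sigmaNat k, E (Formula.all ψ) φ := by
  obtain ⟨χ, hχ, e⟩ := h
  suffices ∃ ψ ∈ sigmaNat k, E (Formula.all ψ) χ from
    this.imp fun ψ hψ => ⟨hψ.1, hE.trans hψ.2 e⟩
  refine piNat_succ_induction (P := fun χ => ∃ ψ ∈ sigmaNat k, E (Formula.all ψ) χ)
    (fun ψ hψ => ⟨ψ, hψ, hE.refl _⟩) (fun φ _ ⟨ψ, hψ, e⟩ => ?_) hχ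
  exact ⟨_, sigmaNat_subst hψ _, hE.trans (hc ψ hψ) (hE.all e)⟩

/-- Provable equivalence. -/
def ProvEqv (T : Set Formula) (φ ψ : Formula) : Prop := Deriv T [] (iff φ ψ)

theorem quantCongr_provEqv (T : Set Formula) : QuantCongr (ProvEqv T) :=
  ⟨Deriv.iff_refl, Deriv.iff_trans, Deriv.iff_ex, Deriv.iff_all, Deriv.iff_dummy_ex,
    Deriv.iff_dummy_all⟩

/-! ### Closure properties in classical arithmetic -/

/-- Equivalence in all models of classical arithmetic. -/
def Eqv (φ ψ : Formula) : Prop :=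
  ∀ (M : Type) [arith.Structure M] [IsPA M] (ρ : ℕ → M), sat ρ φ ↔ sat ρ ψ

theorem quantCongr_eqv : QuantCongr Eqv where
  refl _ _ _ _ _ := Iff.rfl
  trans h h' M _ _ ρ := (h M ρ).trans (h' M ρ)
  ex h M _ _ ρ := by simp only [sat, h M]
  all h M _ _ ρ := by simp only [sat, h M]
  dummy_ex φ M _ _ ρ := by simp only [sat, sat_shift]; exact ⟨fun ⟨_, h⟩ => h, fun h => ⟨zr, h⟩⟩
  dummy_all φ M _ _ ρ := by simp only [sat, sat_shift]; exact ⟨fun h => h zr, fun h _ => h⟩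

theorem sat_subst_unpairSubst {M : Type} [arith.Structure M] [IsPA M] (φ : Formula) (m : M)
    (ρ : ℕ → M) :
    sat (scons m ρ) (φ.subst unpairSubst) ↔ sat (scons (sn m) (scons (fs m) ρ)) φ := by
  simp only [unpairSubst, sat_subst, realize_scons, realize_fstTm, realize_sndTm, realize_v,
    scons_zero, scons_succ]

theorem exists_ex_eqv {k : ℕ} {φ : Formula} (h : IsSigma Eqv (k + 1) φ) :
    ∃ ψ ∈ piNat k, Eqv (ex ψ) φ := by
  refine quantCongr_eqv.exists_ex (fun φ _ M _ _ ρ => ?_) h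
  simp only [sat, sat_subst_unpairSubst]
  exact ⟨fun ⟨m, h⟩ => ⟨_, _, h⟩, fun ⟨a, b, h⟩ => ⟨pr a b, by rwa [fs_pr, sn_pr]⟩⟩

theorem exists_all_eqv {k : ℕ} {φ : Formula} (h : IsPi Eqv (k + 1) φ) :
    ∃ ψ ∈ sigmaNat k, Eqv (all ψ) φ := by
  refine quantCongr_eqv.exists_all (fun φ _ M _ _ ρ => ?_) h
  simp only [sat, sat_subst_unpairSubst]
  exact ⟨fun h a b => by simpa only [fs_pr, sn_pr] using h (pr a b), fun h m => h _ _⟩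

theorem isSigma_subst {k : ℕ} {φ : Formula} (h : IsSigma Eqv k φ) (σ : ℕ → Tm) :
    IsSigma Eqv k (φ.subst σ) :=
  let ⟨_, hψ, e⟩ := h
  ⟨_, sigmaNat_subst hψ σ, fun M _ _ ρ => by rw [sat_subst, sat_subst, e M]⟩

theorem isPi_subst {k : ℕ} {φ : Formula} (h : IsPi Eqv k φ) (σ : ℕ → Tm) :
    IsPi Eqv k (φ.subst σ) :=
  let ⟨_, hψ, e⟩ := h
  ⟨_, piNat_subst hψ σ, fun M _ _ ρ => by rw [sat_subst, sat_subst, e M]⟩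

theorem isSigma_of_mem {k : ℕ} {φ : Formula} (h : φ ∈ sigmaNat k) : IsSigma Eqv k φ :=
  ⟨φ, h, fun _ _ _ _ => Iff.rfl⟩

theorem isPi_of_mem {k : ℕ} {φ : Formula} (h : φ ∈ piNat k) : IsPi Eqv k φ :=
  ⟨φ, h, fun _ _ _ _ => Iff.rfl⟩

theorem isPi_neg_and_isSigma_neg (k : ℕ) :
    (∀ φ, IsSigma Eqv k φ → IsPi Eqv k (neg φ)) ∧ ∀ φ, IsPi Eqv k φ → IsSigma Eqv k (neg φ) := by
  induction k with
  | zero =>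
    refine ⟨fun φ ⟨ψ, hψ, e⟩ => ⟨neg ψ, ?_, fun M _ _ ρ => not_congr (e M ρ)⟩,
      fun φ ⟨ψ, hψ, e⟩ => ⟨neg ψ, ?_, fun M _ _ ρ => not_congr (e M ρ)⟩⟩
    · exact mem_piNat_zero.2 ⟨mem_sigmaNat_zero.1 hψ, trivial⟩
    · exact mem_sigmaNat_zero.2 ⟨mem_piNat_zero.1 hψ, trivial⟩
  | succ k ih =>
    constructor
    · intro φ h
      obtain ⟨ψ, hψ, e⟩ := exists_ex_eqv h
      refine quantCongr_eqv.isPi_congr (quantCongr_eqv.isPi_all (ih.2 ψ (isPi_of_mem hψ))) ?_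
      intro M _ _ ρ
      rw [sat_neg, ← e M ρ]
      simp only [sat, sat_neg, not_exists]
    · intro φ h
      obtain ⟨ψ, hψ, e⟩ := exists_all_eqv h
      refine quantCongr_eqv.isSigma_congr
        (quantCongr_eqv.isSigma_ex (ih.1 ψ (isSigma_of_mem hψ))) ?_
      intro M _ _ ρ
      rw [sat_neg, ← e M ρ]
      simp only [sat, sat_neg, not_forall]

theorem isPi_neg {k : ℕ} {φ : Formula} (h : IsSigma Eqv k φ) : IsPi Eqv k (neg φ) :=
  (isPi_neg_and_isSigma_neg k).1 φ h

theorem isSigma_neg {k : ℕ} {φ : Formula} (h : IsPi Eqv k φ) : IsSigma Eqv k (neg φ) :=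
  (isPi_neg_and_isSigma_neg k).2 φ h

theorem isSigma_and_and_isPi_and (k : ℕ) :
    (∀ φ ψ, IsSigma Eqv k φ → IsSigma Eqv k ψ → IsSigma Eqv k (and φ ψ)) ∧
      ∀ φ ψ, IsPi Eqv k φ → IsPi Eqv k ψ → IsPi Eqv k (and φ ψ) := by
  induction k with
  | zero =>
    refine ⟨fun φ φ' ⟨ψ, hψ, e⟩ ⟨ψ', hψ', e'⟩ => ⟨and ψ ψ', ?_, fun M _ _ ρ => ?_⟩,
      fun φ φ' ⟨ψ, hψ, e⟩ ⟨ψ', hψ', e'⟩ => ⟨and ψ ψ', ?_, fun M _ _ ρ => ?_⟩⟩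
    · exact mem_sigmaNat_zero.2 ⟨mem_sigmaNat_zero.1 hψ, mem_sigmaNat_zero.1 hψ'⟩
    · exact and_congr (e M ρ) (e' M ρ)
    · exact mem_piNat_zero.2 ⟨mem_piNat_zero.1 hψ, mem_piNat_zero.1 hψ'⟩
    · exact and_congr (e M ρ) (e' M ρ)
  | succ k ih =>
    constructor
    · intro φ φ' h h'
      obtain ⟨ψ, hψ, e⟩ := exists_ex_eqv h
      obtain ⟨ψ', hψ', e'⟩ := exists_ex_eqv h'
      refine quantCongr_eqv.isSigma_congr (quantCongr_eqv.isSigma_ex_succ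
        (quantCongr_eqv.isSigma_ex (ih.2 _ _
          (isPi_subst (isPi_of_mem hψ) (scons (v 1) fun i => v (i + 2)))
          (isPi_subst (isPi_of_mem hψ') (scons (v 0) fun i => v (i + 2)))))) ?_
      intro M _ _ ρ
      simp only [sat, ← e M ρ, ← e' M ρ, sat_subst, realize_scons, realize_v, scons_zero,
        scons_succ]
      exact ⟨fun ⟨a, b, h, h'⟩ => ⟨⟨a, h⟩, b, h'⟩, fun ⟨⟨a, h⟩, b, h'⟩ => ⟨a, b, h, h'⟩⟩
    · intro φ φ' h h'
      obtain ⟨ψ, hψ, e⟩ := exists_all_eqv h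
      obtain ⟨ψ', hψ', e'⟩ := exists_all_eqv h'
      refine quantCongr_eqv.isPi_congr (quantCongr_eqv.isPi_all
        (ih.1 _ _ (isSigma_of_mem hψ) (isSigma_of_mem hψ'))) ?_
      intro M _ _ ρ
      simp only [sat, ← e M ρ, ← e' M ρ, forall_and]

theorem isSigma_and {k : ℕ} {φ ψ : Formula} (h : IsSigma Eqv k φ) (h' : IsSigma Eqv k ψ) :
    IsSigma Eqv k (and φ ψ) := (isSigma_and_and_isPi_and k).1 φ ψ h h'

theorem isPi_and {k : ℕ} {φ ψ : Formula} (h : IsPi Eqv k φ) (h' : IsPi Eqv k ψ) :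
    IsPi Eqv k (and φ ψ) := (isSigma_and_and_isPi_and k).2 φ ψ h h'

theorem ball_congr {φ ψ : Formula} (h : Eqv φ ψ) : Eqv (ball φ) (ball ψ) := by
  intro M _ _ ρ
  rw [← scons_eta ρ, sat_ball, sat_ball]
  simp only [h M]

/-- The formula `φ` about an entry of a sequence: if the variables `0` and `1` of `φ` are `z` and
`y`, then the variables `0`, `1` and `2` of the result are `y`, a sequence and its length, and `z`
is the entry of the sequence that belongs to `y`. -/
def entrySubst (φ : Formula) : Formula :=
  φ.subst (scons (entryTm (ap2 subC (succTm (v 0)) (v 2)) (v 1)) (scons (v 0) fun i => v (i + 3)))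

theorem sat_entrySubst {M : Type} [arith.Structure M] [IsPA M] (φ : Formula) (y s x : M)
    (ρ : ℕ → M) : sat (scons y (scons s (scons x ρ))) (entrySubst φ) ↔
      sat (scons (entry (op2 subC (sc y) x) s) (scons y ρ)) φ := by
  simp only [entrySubst, sat_subst, realize_scons, realize_entryTm, realize_ap2, realize_succTm,
    realize_v, scons_zero, scons_succ]

/-- The number `x` plays two roles, the bound of `y` and the length from which the index is
computed; the substitution `scons (v 1) v` identifies them. -/
theorem sat_ex_ball_entrySubst {M : Type} [arith.Structure M] [IsPA M] (φ : Formula) (x : M)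
    (ρ : ℕ → M) : sat (scons x ρ) (ex ((ball (entrySubst φ)).subst (scons (v 1) v))) ↔
      ∃ s, ∀ y, Less y x → sat (scons (entry (op2 subC (sc y) x) s) (scons y ρ)) φ := by
  simp only [sat, sat_subst, realize_scons, realize_v, scons_one]
  refine exists_congr fun s => ?_
  rw [show (fun i => scons s (scons x ρ) i) = scons s (scons x ρ) from rfl, sat_ball]
  simp only [sat_entrySubst, scons_zero]

/-- Collection. -/
theorem ball_ex_eqv (φ : Formula) :
    Eqv (ex ((ball (entrySubst φ)).subst (scons (v 1) v))) (ball (ex φ)) := by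
  intro M _ _ ρ
  rw [← scons_eta ρ, sat_ex_ball_entrySubst, sat_ball]
  generalize ρ 0 = x
  generalize (fun i => ρ (i + 1)) = ρ
  refine ⟨fun ⟨s, hs⟩ y hy => ⟨_, hs y hy⟩, ?_⟩
  refine IsPA.ind (S := fun x => (∀ y, Less y x → sat (scons y ρ) (ex φ)) →
      ∃ s, ∀ y, Less y x → sat (scons (entry (op2 subC (sc y) x) s) (scons y ρ)) φ)
    (imp (ball (ex φ)) (ex ((ball (entrySubst φ)).subst (scons (v 1) v)))) ρ (fun x => ?_)
    (fun _ => ⟨zr, fun y hy => (not_less_zr y hy).elim⟩) (fun x ih h => ?_) x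
  · rw [sat, sat_ball, sat_ex_ball_entrySubst]
  · obtain ⟨s, hs⟩ := ih fun y hy => h y (less_sc.2 (.inl hy))
    obtain ⟨z, hz⟩ := h x (less_sc.2 (.inr rfl))
    -- The witness for the new argument `x` is put in front, at index zero; the older entries move
    -- up by one.
    refine ⟨pr z s, fun y hy => ?_⟩
    rcases less_sc.1 hy with hy | rfl
    · rw [sub_of_less hy, entry_sc]
      exact hs y hy
    · rwa [sub_self', entry_zr]

/-- The substitution that exchanges the variables `0` and `1`. -/
def swapSubst : ℕ → Tm := scons (v 1) (scons (v 0) fun i => v (i + 2))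

theorem ball_all_eqv (φ : Formula) :
    Eqv (all ((ball (φ.subst swapSubst)).subst swapSubst)) (ball (all φ)) := by
  intro M _ _ ρ
  rw [← scons_eta ρ, sat_ball]
  generalize ρ 0 = x
  generalize (fun i => ρ (i + 1)) = ρ
  have hs : ∀ (a b : M) (ψ : Formula), sat (scons a (scons b ρ)) (ψ.subst swapSubst) ↔
      sat (scons b (scons a ρ)) ψ := by
    intro a b ψ
    simp only [swapSubst, sat_subst, realize_scons, realize_v, scons_zero, scons_succ]
  simp only [sat, hs, sat_ball]
  exact ⟨fun h y hy m => h m y hy, fun h m y hy => h y hy m⟩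

theorem isSigma_ball_and_isPi_ball (k : ℕ) :
    (∀ φ, IsSigma Eqv k φ → IsSigma Eqv k (ball φ)) ∧
      ∀ φ, IsPi Eqv k φ → IsPi Eqv k (ball φ) := by
  induction k with
  | zero =>
    constructor
    · rintro φ ⟨ψ, hψ, e⟩
      obtain ⟨χ, hχ, e'⟩ := exists_quantifierFree_ball (mem_sigmaNat_zero.1 hψ)
      exact ⟨χ, mem_sigmaNat_zero.2 hχ, quantCongr_eqv.trans e' (ball_congr e)⟩
    · rintro φ ⟨ψ, hψ, e⟩
      obtain ⟨χ, hχ, e'⟩ := exists_quantifierFree_ball (mem_piNat_zero.1 hψ)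
      exact ⟨χ, mem_piNat_zero.2 hχ, quantCongr_eqv.trans e' (ball_congr e)⟩
  | succ k ih =>
    constructor
    · intro φ h
      obtain ⟨ψ, hψ, e⟩ := exists_ex_eqv h
      exact quantCongr_eqv.isSigma_congr (quantCongr_eqv.isSigma_ex (isPi_subst
        (ih.2 _ (isPi_subst (isPi_of_mem hψ) _)) _))
        (quantCongr_eqv.trans (ball_ex_eqv ψ) (ball_congr e))
    · intro φ h
      obtain ⟨ψ, hψ, e⟩ := exists_all_eqv h
      exact quantCongr_eqv.isPi_congr (quantCongr_eqv.isPi_all (isSigma_subst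
        (ih.1 _ (isSigma_subst (isSigma_of_mem hψ) _)) _))
        (quantCongr_eqv.trans (ball_all_eqv ψ) (ball_congr e))

theorem isSigma_ball {k : ℕ} {φ : Formula} (h : IsSigma Eqv k φ) : IsSigma Eqv k (ball φ) :=
  (isSigma_ball_and_isPi_ball k).1 φ h

/-! ### Theories with double negation elimination for `Σ_k` -/

/-- Extensions of Heyting arithmetic that prove the double negation elimination for `Σ_k`. -/
structure HasDNE (T : Set Formula) (k : ℕ) : Prop where
  subset : HA ⊆ T
  stable : ∀ φ ∈ sigmaNat k, Stable T φ

theorem Stable.congr {T : Set Formula} {φ ψ : Formula} (h : Stable T φ) (e : ProvEqv T φ ψ) :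
    Stable T ψ :=
  .impI (e.iff_mp (h.dne (.impE .hyp₁ (.impI (.impE .hyp₁ (e.iff_mpr .hyp₀))))))

section HasDNE

variable {T : Set Formula} {k : ℕ} (hT : HasDNE T k)

include hT

theorem HasDNE.stable_of_le {j : ℕ} (hj : j ≤ k) {φ : Formula} (h : φ ∈ sigmaNat j) :
    Stable T φ := by
  obtain ⟨ψ, hψ, e⟩ := (quantCongr_provEqv T).isSigma_mono hj ⟨φ, h, Deriv.iff_refl φ⟩
  exact (hT.stable ψ hψ).congr e

theorem HasDNE.stable_quantifierFree {φ : Formula} (h : φ.QuantifierFree) : Stable T φ :=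
  hT.stable_of_le (Nat.zero_le k) (mem_sigmaNat_zero.2 h)

theorem HasDNE.stable_eq (t s : Tm) : Stable T (eq t s) := hT.stable_quantifierFree trivial

theorem HasDNE.good_quantifierFree {φ : Formula} (h : φ.QuantifierFree) : Good T φ := by
  induction φ with
  | falsum => exact .falsum
  | eq t s => exact .eq t s
  | and φ ψ h₁ h₂ => exact (h₁ h.1).and (h₂ h.2)
  | or φ ψ h₁ h₂ => exact (h₁ h.1).or (h₂ h.2) (hT.stable_quantifierFree h)
  | imp φ ψ h₁ h₂ => exact (h₁ h.1).imp (h₂ h.2)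
  | all φ _ => exact h.elim
  | ex φ _ => exact h.elim

theorem HasDNE.good_of_le {j : ℕ} (hj : j ≤ k) :
    (∀ φ ∈ sigmaNat j, Good T φ) ∧ ∀ φ ∈ piNat j, Good T φ := by
  induction j with
  | zero =>
    exact ⟨fun φ h => hT.good_quantifierFree (mem_sigmaNat_zero.1 h),
      fun φ h => hT.good_quantifierFree (mem_piNat_zero.1 h)⟩
  | succ j ih =>
    obtain ⟨ih₁, ih₂⟩ := ih (by omega)
    constructor
    · intro φ h
      refine sigmaNat_succ_induction (P := Good T) (fun ψ hψ => ?_) (fun ψ hψ hg => ?_) h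
      · exact (ih₂ ψ hψ).ex (hT.stable_of_le hj (ex_mem_sigmaNat hψ))
      · exact hg.ex (hT.stable_of_le hj (ex_mem_sigmaNat_succ hψ))
    · intro φ h
      exact piNat_succ_induction (P := Good T) (fun ψ hψ => (ih₁ ψ hψ).all)
        (fun ψ _ hg => hg.all) h

theorem HasDNE.good_sigma {φ : Formula} (h : φ ∈ sigmaNat k) : Good T φ :=
  (hT.good_of_le le_rfl).1 φ h

theorem HasDNE.good_pi {φ : Formula} (h : φ ∈ piNat k) : Good T φ :=
  (hT.good_of_le le_rfl).2 φ h

/-- The outer universal block needs no double negation elimination, so goodness reaches one level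
higher on the `Π` side. -/
theorem HasDNE.good_pi_succ {φ : Formula} (h : φ ∈ piNat (k + 1)) : Good T φ :=
  piNat_succ_induction (P := Good T) (fun _ hψ => (hT.good_sigma hψ).all)
    (fun _ _ hg => hg.all) h

theorem HasDNE.deriv {φ : Formula} (h : Good T φ) (hv : Valid φ) : Deriv T [] φ :=
  h.deriv hT.subset hT.stable_eq hv

theorem HasDNE.provEqv {φ ψ : Formula} (h : Good T φ) (h' : Good T ψ) (hv : Eqv φ ψ) :
    ProvEqv T φ ψ :=
  h.deriv_iff h' hT.subset hT.stable_eq hv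

theorem HasDNE.stable_of_good {φ : Formula} (h : Good T φ) : Stable T φ :=
  (Stable.of_isNegative hT.stable_eq (isNegative_negTr φ)).congr h.iff_symm

end HasDNE

theorem Deriv.exI_subst {T : Set Formula} {Γ : List Formula} {φ : Formula} {σ : ℕ → Tm} (t : Tm)
    (h : Deriv T Γ (φ.subst (scons t σ))) : Deriv T Γ ((ex φ).subst σ) :=
  .exI t (by rwa [inst_subst_lift])

/-- Goodness is not available for `Σ_{k+1}` formulas, so contraction is derived by hand; the
transfer only supplies the equations for pairing, inside the `Π_k` matrix. -/
theorem HasDNE.exists_ex {T : Set Formula} {k : ℕ} (hT : HasDNE T k) {φ : Formula}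
    (h : IsSigma (ProvEqv T) (k + 1) φ) : ∃ ψ ∈ piNat k, ProvEqv T (ex ψ) φ := by
  refine (quantCongr_provEqv T).exists_ex (fun φ hφ => .iff_of ?_ ?_) h
  · exact .exE .hyp₀ (.exI_subst (fstTm (v 0)) (.exI_subst (sndTm (v 0)) .hyp₀))
  · refine .exE .hyp₀ (.exE .hyp₀ ?_)
    rw [Formula.shift, Formula.shift, subst_subst]
    refine .exI_subst (pairTm (v 1) (v 0)) (.mp (φ := φ) ?_ .hyp₀)
    refine hT.deriv ((hT.good_pi hφ).imp (hT.good_pi (piNat_subst (piNat_subst hφ _) _)))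
      fun M _ _ ρ h => ?_
    rw [sat_subst, realize_scons, sat_subst_unpairSubst, realize_pairTm, fs_pr, sn_pr]
    exact (congrArg (fun ρ => sat ρ φ) (show _ = ρ from
      (congrArg (scons (ρ 0)) (scons_eta fun i => ρ (i + 1))).trans (scons_eta ρ))).mpr h

theorem Deriv.iff_ex_and_shift {T : Set Formula} (φ ψ : Formula) :
    Deriv T [] (iff (ex (and φ ψ.shift)) (and (ex φ) ψ)) :=
  .iff_of
    (.exE .hyp₀ (.andI (.exI_shift (.andE₁ .hyp₀)) (.andE₂ .hyp₀)))
    (.exE (.andE₁ .hyp₀) (.exI_shift (.andI .hyp₀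
      (.andE₂ (φ := (ex φ).shift) (ψ := ψ.shift) .hyp₁))))

/-- `∃ x (N ∧ A)` is `Σ_{k+1}` if `N` is `Σ_k` and `A` is `Π_k`. -/
theorem HasDNE.isSigma_ex_and {T : Set Formula} {k : ℕ} (hT : HasDNE T k) {N A : Formula}
    (hN : N ∈ sigmaNat k) (hA : A ∈ piNat k) : IsSigma (ProvEqv T) (k + 1) (ex (and N A)) := by
  have hE := quantCongr_provEqv T
  -- Raised by one level and contracted, `N` becomes `∃B` with `B` in `Π_k`, and its quantifier can
  -- be moved in front of the conjunction.
  obtain ⟨B, hB, e⟩ := hT.exists_ex (hE.isSigma_succ ⟨N, hN, hE.refl N⟩)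
  have hA' : A.shift ∈ piNat k := piNat_subst hA _
  obtain ⟨θ, hθ, e'⟩ := isPi_and (isPi_of_mem hB) (isPi_of_mem hA')
  have e₁ := hT.provEqv (hT.good_pi hθ) ((hT.good_pi hB).and (hT.good_pi hA')) e'
  refine hE.isSigma_congr (hE.isSigma_ex_succ (hE.isSigma_ex ⟨θ, hθ, e₁⟩)) (hE.ex ?_)
  exact hE.trans (Deriv.iff_ex_and_shift B A) (e.iff_and (hE.refl A))

/-! ### De Morgan's law -/

/-- `T` proves De Morgan's law for `Δ_k`. -/
def HasDML (T : Set Formula) (k : ℕ) : Prop := ∀ χ ∈ DMLDelta (k : ℤ), Deriv T [] χ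

theorem HasDML.or_neg {T : Set Formula} {k : ℕ} (h : HasDML T k) {X X' Z Z' : Formula}
    (hX : IsSigma (ProvEqv T) k X) (hX' : IsPi (ProvEqv T) k X') (hZ : IsSigma (ProvEqv T) k Z)
    (hZ' : IsPi (ProvEqv T) k Z') {Γ : List Formula} (h₁ : Deriv T Γ (iff X X'))
    (h₂ : Deriv T Γ (iff Z Z')) (h₃ : Deriv T Γ (neg (and X Z))) :
    Deriv T Γ (or (neg X) (neg Z)) := by
  obtain ⟨X₁, hX₁, eX⟩ := hX
  obtain ⟨X₂, hX₂, eX'⟩ := hX'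
  obtain ⟨Z₁, hZ₁, eZ⟩ := hZ
  obtain ⟨Z₂, hZ₂, eZ'⟩ := hZ'
  have h₀ := h _ ⟨X₁, hX₁, Z₁, hZ₁, X₂, hX₂, Z₂, hZ₂, rfl⟩
  have key : ∀ {Y Y' Y₁ Y₂ : Formula}, ProvEqv T Y₁ Y → ProvEqv T Y₂ Y' → Deriv T Γ (iff Y Y') →
      Deriv T Γ (iff Y₁ Y₂) := by
    intro Y Y' Y₁ Y₂ e e' h
    have h' : ∀ χ, Deriv T (χ :: Γ) (iff Y Y') := fun χ => h.weaken (List.subset_cons_self _ _)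
    exact .andI (.impI (e'.iff_mpr (.impE (.andE₁ (h' _)) (e.iff_mp .hyp₀))))
      (.impI (e.iff_mpr (.impE (.andE₂ (h' _)) (e'.iff_mp .hyp₀))))
  have h₄ : Deriv T Γ (neg (and X₁ Z₁)) :=
    .impI (.impE (h₃.weaken (List.subset_cons_self _ _)) ((eX.iff_and eZ).iff_mp .hyp₀))
  refine .orE (.impE (.mp h₀ (.andI (key eX eX' h₁) (key eZ eZ' h₂))) h₄) (.orI₁ ?_) (.orI₂ ?_)
  · exact (eX.iff_imp (Deriv.iff_refl falsum)).iff_mp .hyp₀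
  · exact (eZ.iff_imp (Deriv.iff_refl falsum)).iff_mp .hyp₀

/-- De Morgan's law for `Δ_{k+1}` yields the law of excluded middle for `Π_k`. -/
theorem HasDML.em {T : Set Formula} {k : ℕ} (h : HasDML T (k + 1)) (hT : HasDNE T k) {π : Formula}
    (hπ : π ∈ piNat k) : Deriv T [] (or π (neg π)) := by
  have hE := quantCongr_provEqv T
  obtain ⟨σ, hσ, e⟩ := isSigma_neg (isPi_of_mem hπ)
  have gπ := hT.good_pi hπ
  have gσ := hT.good_sigma hσ
  have h₁ : IsPi (ProvEqv T) k π := ⟨π, hπ, hE.refl π⟩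
  have h₂ : IsSigma (ProvEqv T) k σ := ⟨σ, hσ, hE.refl σ⟩
  -- The law is applied to `π` and a `Σ_k` form `σ` of `¬π`, both of which are `Δ_{k+1}`; `¬σ` gives
  -- `π` back by classical transfer.
  refine .orE (h.or_neg (hE.isSigma_of_isPi h₁) (hE.isPi_succ h₁) (hE.isSigma_succ h₂)
    (hE.isPi_of_isSigma h₂) (hE.refl π) (hE.refl σ) ?_) (.orI₂ .hyp₀) (.orI₁ (.mp ?_ .hyp₀))
  · exact hT.deriv (gπ.and gσ).neg fun M _ _ ρ h => (e M ρ).1 h.2 h.1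
  · exact hT.deriv (gσ.neg.imp gπ) fun M _ _ ρ h => by_contra fun h' => h ((e M ρ).2 h')

/-! ### Separation of two existential formulas -/

/-- The least number principle. -/
theorem exists_least {M : Type} [arith.Structure M] [IsPA M] (φ : Formula) (ρ : ℕ → M) {x : M}
    (hx : sat (scons x ρ) φ) :
    ∃ y, sat (scons y ρ) φ ∧ ∀ z, Less z y → ¬ sat (scons z ρ) φ := by
  by_contra hne
  push Not at hne
  have key : ∀ x, ∀ z, Less z x → ¬ sat (scons z ρ) φ := by
    refine IsPA.ind (S := fun x => ∀ z, Less z x → ¬ sat (scons z ρ) φ) (ball (neg φ)) ρ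
      (fun x => by rw [sat_ball]; rfl) (fun z hz => (not_less_zr z hz).elim) fun x ih z hz h => ?_
    rcases less_sc.1 hz with hz | rfl
    · exact ih z hz h
    · obtain ⟨y, hy, hy'⟩ := hne z h
      exact ih y hy hy'
  exact key (sc x) x (less_sc.2 (.inr rfl)) hx

/-- The data for the separation of `∃ x A` and `∃ x C`: `N` says that there are no smaller
witnesses for `A` or `C`, and `N'` says in addition that `A` fails. The formulas `X` and `Z`
deny that a witness for `C`, respectively for `A`, comes first. -/
structure Separation (k : ℕ) (A C N N' X Z : Formula) : Prop where
  hA : A ∈ piNat k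
  hC : C ∈ piNat k
  hN : N ∈ sigmaNat k
  hN' : N' ∈ sigmaNat k
  hX : X ∈ piNat (k + 1)
  hZ : Z ∈ piNat (k + 1)
  eN : Eqv N (ball (and (neg A) (neg C)))
  eN' : Eqv N' (and N (neg A))
  eX : Eqv X (neg (ex (and N' C)))
  eZ : Eqv Z (neg (ex (and N A)))

theorem exists_separation {k : ℕ} {A C : Formula} (hA : A ∈ piNat k) (hC : C ∈ piNat k) :
    ∃ N N' X Z, Separation k A C N N' X Z := by
  have nA := isSigma_neg (isPi_of_mem hA)
  have nC := isSigma_neg (isPi_of_mem hC)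
  obtain ⟨N, hN, eN⟩ := isSigma_ball (isSigma_and nA nC)
  obtain ⟨N', hN', eN'⟩ := isSigma_and (isSigma_of_mem hN) nA
  have key : ∀ {B D}, B ∈ sigmaNat k → D ∈ piNat k → IsPi Eqv (k + 1) (neg (ex (and B D))) :=
    fun hB hD => isPi_neg (quantCongr_eqv.isSigma_ex_succ (isSigma_and
      (quantCongr_eqv.isSigma_succ (isSigma_of_mem hB))
      (quantCongr_eqv.isSigma_of_isPi (isPi_of_mem hD))))
  obtain ⟨X, hX, eX⟩ := key hN' hC
  obtain ⟨Z, hZ, eZ⟩ := key hN hA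
  exact ⟨N, N', X, Z, hA, hC, hN, hN', hX, hZ, eN, eN', eX, eZ⟩

namespace Separation

variable {k : ℕ} {A C N N' X Z : Formula} (S : Separation k A C N N' X Z)

include S

section Sat

variable {M : Type} [arith.Structure M] [IsPA M] (ρ : ℕ → M)

theorem sat_N (x : M) : sat (scons x ρ) N ↔
    ∀ y, Less y x → ¬ sat (scons y ρ) A ∧ ¬ sat (scons y ρ) C := by
  rw [S.eN M, sat_ball]; rfl

theorem sat_N' (x : M) : sat (scons x ρ) N' ↔ sat (scons x ρ) N ∧ ¬ sat (scons x ρ) A :=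
  S.eN' M _

theorem sat_X : sat ρ X ↔ ¬ ∃ x, sat (scons x ρ) N' ∧ sat (scons x ρ) C := S.eX M ρ

theorem sat_Z : sat ρ Z ↔ ¬ ∃ x, sat (scons x ρ) N ∧ sat (scons x ρ) A := S.eZ M ρ

/-- Of two different witnesses the smaller one refutes the minimality of the other; at equal
witnesses `N'` refutes `A`. -/
theorem exclusive {x y : M} (h : sat (scons x ρ) N ∧ sat (scons x ρ) A)
    (h' : sat (scons y ρ) N' ∧ sat (scons y ρ) C) : False := by
  rw [S.sat_N] at h
  rw [S.sat_N', S.sat_N] at h'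
  rcases less_trichotomy x y with hxy | rfl | hxy
  · exact (h'.1.1 x hxy).1 h.2
  · exact h'.1.2 h.2
  · exact (h.1 y hxy).2 h'.2

/-- The least witness of `A ∨ C` counts for `A` if it satisfies `A`, and for `C` otherwise. -/
theorem exhaustive {x : M} (h : sat (scons x ρ) A ∨ sat (scons x ρ) C) :
    (∃ x, sat (scons x ρ) N ∧ sat (scons x ρ) A) ∨
      ∃ x, sat (scons x ρ) N' ∧ sat (scons x ρ) C := by
  obtain ⟨y, hy, hy'⟩ := exists_least (or A C) ρ h
  have hN : sat (scons y ρ) N := (S.sat_N ρ y).2 fun z hz => not_or.1 (hy' z hz)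
  by_cases hA : sat (scons y ρ) A
  · exact .inl ⟨y, hN, hA⟩
  · exact .inr ⟨y, (S.sat_N' ρ y).2 ⟨hN, hA⟩, hy.resolve_left hA⟩

end Sat

section Deriv

variable {T : Set Formula} (hT : HasDNE T k)

include hT

/-- Implications between these formulas need to be checked in classical models only. The `Σ_{k+1}`
formulas `∃x (N ∧ A)` and `∃x (N' ∧ C)` are missing here, which is why the lemmas below keep the
witness as free variable `0` and shift `X` and `Z`. -/
theorem good : Good T A ∧ Good T C ∧ Good T N ∧ Good T N' ∧ Good T X ∧ Good T Z ∧
    Good T X.shift ∧ Good T Z.shift :=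
  ⟨hT.good_pi S.hA, hT.good_pi S.hC, hT.good_sigma S.hN, hT.good_sigma S.hN',
    hT.good_pi_succ S.hX, hT.good_pi_succ S.hZ, hT.good_pi_succ (piNat_subst S.hX _),
    hT.good_pi_succ (piNat_subst S.hZ _)⟩

theorem deriv_X : Deriv T [] (imp (and N A) X.shift) := by
  obtain ⟨gA, gC, gN, gN', gX, gZ, gX', gZ'⟩ := S.good hT
  refine hT.deriv ((gN.and gA).imp gX') fun M _ _ ρ => ?_
  rw [← scons_eta ρ, sat, sat_shift, S.sat_X]
  exact fun h ⟨y, h'⟩ => S.exclusive _ h h'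

theorem deriv_Z : Deriv T [] (imp (and N' C) Z.shift) := by
  obtain ⟨gA, gC, gN, gN', gX, gZ, gX', gZ'⟩ := S.good hT
  refine hT.deriv ((gN'.and gC).imp gZ') fun M _ _ ρ => ?_
  rw [← scons_eta ρ, sat, sat_shift, S.sat_Z]
  exact fun h ⟨y, h'⟩ => S.exclusive _ h' h

theorem deriv_not_X : Deriv T [] (imp (and N' C) (neg X.shift)) := by
  obtain ⟨gA, gC, gN, gN', gX, gZ, gX', gZ'⟩ := S.good hT
  refine hT.deriv ((gN'.and gC).imp gX'.neg) fun M _ _ ρ => ?_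
  rw [← scons_eta ρ, sat, sat_neg, sat_shift, S.sat_X]
  exact fun h h' => h' ⟨_, h⟩

theorem deriv_not_Z : Deriv T [] (imp (and N A) (neg Z.shift)) := by
  obtain ⟨gA, gC, gN, gN', gX, gZ, gX', gZ'⟩ := S.good hT
  refine hT.deriv ((gN.and gA).imp gZ'.neg) fun M _ _ ρ => ?_
  rw [← scons_eta ρ, sat, sat_neg, sat_shift, S.sat_Z]
  exact fun h h' => h' ⟨_, h⟩

theorem deriv_of_X : Deriv T [] (imp X
    (imp (neg (and (all (neg A)) (all (neg C)))) (neg (all (neg A))))) := by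
  obtain ⟨gA, gC, gN, gN', gX, gZ, gX', gZ'⟩ := S.good hT
  refine hT.deriv (gX.imp ((gA.neg.all.and gC.neg.all).neg.imp gA.neg.all.neg)) ?_
  intro M _ _ ρ h h₁ h₂
  refine h₁ ⟨h₂, fun x hx => ?_⟩
  rcases S.exhaustive ρ (.inr hx) with ⟨y, _, hy⟩ | h₃
  · exact h₂ y hy
  · exact (S.sat_X ρ).1 h h₃

theorem deriv_of_Z : Deriv T [] (imp Z
    (imp (neg (and (all (neg A)) (all (neg C)))) (neg (all (neg C))))) := by
  obtain ⟨gA, gC, gN, gN', gX, gZ, gX', gZ'⟩ := S.good hT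
  refine hT.deriv (gZ.imp ((gA.neg.all.and gC.neg.all).neg.imp gC.neg.all.neg)) ?_
  intro M _ _ ρ h h₁ h₂
  refine h₁ ⟨fun x hx => ?_, h₂⟩
  rcases S.exhaustive ρ (.inl hx) with h₃ | ⟨y, _, hy⟩
  · exact (S.sat_Z ρ).1 h h₃
  · exact h₂ y hy

/-- Classical transfer does not apply to a disjunction of `Σ_{k+1}` formulas, so this is a genuine
intuitionistic induction on `x`: either the search has succeeded, or there is no witness below `x`.
Excluded middle for `A` and `C` decides each step. -/
theorem deriv_or (hD : HasDML T (k + 1)) : Deriv T [] (imp (or A C)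
    (or (ex (and N A)) (ex (and N' C))).shift) := by
  obtain ⟨gA, gC, gN, gN', gX, gZ, gX', gZ'⟩ := S.good hT
  have emA := hD.em hT S.hA
  have emC := hD.em hT S.hC
  have hA : ∀ {Γ}, Deriv T Γ N → Deriv T Γ A →
      Deriv T Γ (or (ex (and N A)) (ex (and N' C))).shift :=
    fun h h' => .orI₁ (.exI_shift (.andI h h'))
  have hC : ∀ {Γ}, Deriv T Γ N → Deriv T Γ (neg A) → Deriv T Γ C →
      Deriv T Γ (or (ex (and N A)) (ex (and N' C))).shift := by
    refine fun h h' h'' => .orI₂ (.exI_shift (.andI (.mp ?_ (.andI h h')) h''))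
    exact hT.deriv ((gN.and gA.neg).imp gN') fun M _ _ ρ => (S.eN' M ρ).2
  generalize or (ex (and N A)) (ex (and N' C)) = W at hA hC ⊢
  -- The induction variable does not occur in the outcome of the search.
  have hs : W.shift.subst succSubst = W.shift := by
    rw [Formula.shift, subst_subst]; rfl
  have h0 : Deriv T [] ((or W.shift N).inst zeroTm) := by
    refine .orI₂ (hT.deriv (hT.good_sigma (sigmaNat_subst S.hN _)) fun M _ _ ρ => ?_)
    change sat ρ (N.inst zeroTm)
    rw [sat_inst, S.sat_N, realize_zeroTm]
    exact fun y hy => (not_less_zr y hy).elim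
  have hsucc : Deriv T [] (imp (and N (and (neg A) (neg C))) (N.subst succSubst)) := by
    refine hT.deriv ((gN.and (gA.neg.and gC.neg)).imp
      (hT.good_sigma (sigmaNat_subst S.hN _))) fun M _ _ ρ => ?_
    rw [← scons_eta ρ]
    generalize ρ 0 = x
    generalize (fun i => ρ (i + 1)) = ρ
    have : (fun i => (succSubst i).realize (scons x ρ)) = scons (sc x) ρ := by
      funext i; cases i <;> rfl
    rw [sat, sat_subst, this, S.sat_N]
    intro h y hy
    rcases less_sc.1 hy with hy | rfl
    · exact (S.sat_N ρ x).1 h.1 y hy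
    · exact h.2
  have hstep : Deriv T [] (imp (or W.shift N) ((or W.shift N).subst succSubst)) := by
    simp only [Formula.subst, hs]
    refine .impI (.orE .hyp₀ (.orI₁ .hyp₀) (.orE emA.lift (.orI₁ (hA .hyp₁ .hyp₀))
      (.orE emC.lift (.orI₁ (hC .hyp₂ .hyp₁ .hyp₀)) (.orI₂ (.mp hsucc ?_)))))
    exact .andI .hyp₂ (.andI .hyp₁ .hyp₀)
  have hall : Deriv T [] (all (or W.shift N)) :=
    .impE (.impE (Deriv.of_closure_mem (hT.subset ⟨_, .induction _, rfl⟩)) h0) (.allI hstep)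
  have hI : Deriv T [] (or W.shift N) := .allE_shift (hall.subst _)
  -- If nothing was found below `x`, then `x` is the least witness. `A` is decided even when `C` is
  -- given, since `N'` requires its failure.
  refine .impI (.orE hI.lift .hyp₀ (.orE emA.lift (hA .hyp₁ .hyp₀) (hC .hyp₁ .hyp₀ ?_)))
  exact .orE .hyp₂ (.falsumE (.impE .hyp₁ .hyp₀)) .hyp₀

end Deriv

end Separation

-- From the separation to De Morgan's law for negations

/-- If `Y` is incompatible with the second of two alternatives that cover `φ`, and `φ` follows
from `Y`, then `Y` is equivalent to the first alternative. -/
theorem Deriv.iff_ex_of_cover {T : Set Formula} {Γ : List Formula} {P Q Y φ : Formula}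
    (h₁ : Deriv T [] (imp P Y.shift)) (h₂ : Deriv T [] (imp Q (neg Y.shift)))
    (h₃ : Deriv T (Y :: Γ) φ) (h₄ : Deriv T [φ] (or (ex P) (ex Q))) :
    Deriv T Γ (iff (ex P) Y) :=
  .andI (.impI (.exE .hyp₀ (.mp h₁ .hyp₀)))
    (.impI (.orE (.cut_single h₃ h₄) .hyp₀
      (.exE .hyp₀ (.falsumE (.impE (.mp h₂ .hyp₀) .hyp₂)))))

theorem Deriv.iff_neg_ex {T : Set Formula} {A φ : Formula} (h : ProvEqv T (ex A) φ) :
    Deriv T [] (iff (all (neg A)) (neg φ)) :=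
  .iff_of
    (.impI (.exE (h.iff_mpr .hyp₀) (.impE (ψ := falsum)
      (.allE_shift (φ := neg A) (.hyp (by simp))) .hyp₀)))
    (.allI (.impI (.impE (φ := φ.shift) (ψ := falsum) .hyp₁
      (.mp (φ := (ex A).shift) ((Deriv.impI (h.iff_mp .hyp₀)).subst _) (.exI_shift .hyp₀)))))

theorem Stable.of_iff {T : Set Formula} {Γ : List Formula} {φ ψ : Formula} (h : Stable T ψ)
    (e : Deriv T Γ (iff φ ψ)) (h' : Deriv T Γ (Formula.neg (Formula.neg φ))) : Deriv T Γ φ := by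
  have hs : ∀ {Δ}, Γ ⊆ Δ → Deriv T Δ (iff φ ψ) := fun hs => e.weaken hs
  refine .impE (.andE₂ e) (h.dne (.impE (h'.weaken (by simp)) (.impI (.impE .hyp₁
    (.impE (.andE₁ (hs ?_)) .hyp₀)))))
  exact fun x hx => by simp [hx]

theorem HasDML.neg_deMorgan {T : Set Formula} {k : ℕ} (hD : HasDML T (k + 1)) (hT : HasDNE T k)
    {φ ψ φ' ψ' : Formula} (hφ : φ ∈ sigmaNat (k + 1)) (hψ : ψ ∈ sigmaNat (k + 1))
    (hφ' : φ' ∈ piNat (k + 1)) (hψ' : ψ' ∈ piNat (k + 1)) :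
    Deriv T [] (imp (and (iff φ φ') (iff ψ ψ')) (deMorgan (neg φ) (neg ψ))) := by
  have hE := quantCongr_provEqv T
  obtain ⟨A, hA, eA⟩ := hT.exists_ex ⟨φ, hφ, hE.refl φ⟩
  obtain ⟨C, hC, eC⟩ := hT.exists_ex ⟨ψ, hψ, hE.refl ψ⟩
  obtain ⟨N, N', X, Z, S⟩ := exists_separation hA hC
  have sφ : Stable T φ' := hT.stable_of_good (hT.good_pi_succ hφ')
  have sψ : Stable T ψ' := hT.stable_of_good (hT.good_pi_succ hψ')
  have cover := S.deriv_or hT hD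
  have hφW : Deriv T [φ] (or (ex (and N A)) (ex (and N' C))) :=
    .exE (eA.iff_mpr .hyp₀) (.mp cover (.orI₁ .hyp₀))
  have hψW : Deriv T [ψ] (or (ex (and N A)) (ex (and N' C))) :=
    .exE (eC.iff_mpr .hyp₀) (.mp cover (.orI₂ .hyp₀))
  have hψW' : Deriv T [ψ] (or (ex (and N' C)) (ex (and N A))) :=
    .orE hψW (.orI₂ .hyp₀) (.orI₁ .hyp₀)
  have hPφ : Deriv T [ex (and N A)] φ :=
    eA.iff_mp (.exE .hyp₀ (.exI_shift (.andE₂ .hyp₀)))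
  have hQψ : Deriv T [ex (and N' C)] ψ :=
    eC.iff_mp (.exE .hyp₀ (.exI_shift (.andE₂ .hyp₀)))
  have hX := S.deriv_X hT
  have hZ := S.deriv_Z hT
  have hnX := S.deriv_not_X hT
  have hnZ := S.deriv_not_Z hT
  have hofX := S.deriv_of_X hT
  have hofZ := S.deriv_of_Z hT
  have iA := Deriv.iff_neg_ex eA
  have iC := Deriv.iff_neg_ex eC
  have sP := hT.isSigma_ex_and S.hN hA
  have sQ := hT.isSigma_ex_and S.hN' hC
  generalize and N A = P at *
  generalize and N' C = Q at *
  have hH : ∀ {Γ}, Deriv T Γ (neg (and (neg φ) (neg ψ))) →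
      Deriv T Γ (neg (and (all (neg A)) (all (neg C)))) := fun h =>
    ((iA.iff_and iC).iff_imp (Deriv.iff_refl falsum)).iff_mpr h
  have nn : ∀ {Γ B χ}, ProvEqv T (all (neg B)) (neg χ) → Deriv T Γ (neg (all (neg B))) →
      Deriv T Γ (neg (neg χ)) := fun e h => (Deriv.iff_imp e (Deriv.iff_refl falsum)).iff_mp h
  refine .impI (.impI ?_)
  -- `X` excludes the second alternative, so `¬¬φ` holds; the assumed equivalence with the stable
  -- formula `φ'` removes the double negation.
  have hφX : Deriv T [X, neg (and (neg φ) (neg ψ)), and (iff φ φ') (iff ψ ψ')] φ :=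
    sφ.of_iff (.andE₁ .hyp₂) (nn iA (.impE (.mp hofX .hyp₀) (hH .hyp₁)))
  have hψZ : Deriv T [Z, neg (and (neg φ) (neg ψ)), and (iff φ φ') (iff ψ ψ')] ψ :=
    sψ.of_iff (.andE₂ .hyp₂) (nn iC (.impE (.mp hofZ .hyp₀) (hH .hyp₁)))
  have h₁ := Deriv.iff_ex_of_cover hX hnX hφX hφW
  have h₂ := Deriv.iff_ex_of_cover hZ hnZ hψZ hψW'
  have h₃ : Deriv T [] (neg (and (ex P) (ex Q))) := by
    have hPX : Deriv T [ex P] X := .exE .hyp₀ (.mp hX .hyp₀)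
    refine .impI (.cut (.cut_single (.andE₁ .hyp₀) hPX) (.exE (.andE₂ .hyp₁) ?_))
    exact .impE (φ := X.shift) (ψ := falsum) (.mp hnX .hyp₀) .hyp₁
  -- Under the assumptions `∃P` and `∃Q` are `Δ_{k+1}`, by `h₁` and `h₂`. The alternatives cross
  -- over: `¬∃P` leads to `¬¬ψ`, since then `φ` would imply `∃Q` and so `ψ`; `¬∃Q` leads to `¬¬φ`.
  refine .orE (hD.or_neg sP ⟨X, S.hX, hE.refl X⟩ sQ ⟨Z, S.hZ, hE.refl Z⟩ h₁ h₂ h₃.lift)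
    (.orI₂ (.impI (.impE .hyp₂ (.andI (.impI ?_) .hyp₀))))
    (.orI₁ (.impI (.impE .hyp₂ (.andI .hyp₀ (.impI ?_)))))
  · exact .orE (.cut_single .hyp₀ hφW) (.impE .hyp₃ .hyp₀)
      (.impE .hyp₂ (.cut_single .hyp₀ hQψ))
  · exact .orE (.cut_single .hyp₀ hψW) (.impE .hyp₂ (.cut_single .hyp₀ hPφ))
      (.impE .hyp₃ .hyp₀)

end HeytingArith

-- The main theorem

open HeytingArith in
theorem mainTheorem8 (k : ℕ) :
    HeytingArith.Proves
      (HeytingArith.addPrinciple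
        (HeytingArith.addPrinciple HeytingArith.HA (HeytingArith.DMLDelta (k : ℤ)))
        (HeytingArith.DNE (HeytingArith.sigmaClass ((k : ℤ) - 1))))
      (HeytingArith.DMLNegDelta (k : ℤ)) := by
  have hD : HasDML (addPrinciple (addPrinciple HA (DMLDelta (k : ℤ)))
      (DNE (sigmaClass ((k : ℤ) - 1)))) k :=
    fun χ hχ => .of_closure_mem (.inl (.inr ⟨χ, hχ, rfl⟩))
  rintro _ ⟨φ, hφ, ψ, hψ, φ', hφ', ψ', hψ', rfl⟩
  cases k with
  | zero =>
    -- At level zero each negation is quantifier-free and serves as its own `Π_0` equivalent; double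
    -- negation elimination is not needed.
    have h₁ : φ.neg ∈ sigmaNat 0 := mem_sigmaNat_zero.2 ⟨mem_sigmaNat_zero.1 hφ, trivial⟩
    have h₂ : ψ.neg ∈ sigmaNat 0 := mem_sigmaNat_zero.2 ⟨mem_sigmaNat_zero.1 hψ, trivial⟩
    have h₃ : φ.neg ∈ piNat 0 := mem_piNat_zero.2 (mem_sigmaNat_zero.1 h₁)
    have h₄ : ψ.neg ∈ piNat 0 := mem_piNat_zero.2 (mem_sigmaNat_zero.1 h₂)
    exact .impI (.mp (hD _ ⟨φ.neg, h₁, ψ.neg, h₂, φ.neg, h₃, ψ.neg, h₄, rfl⟩)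
      (.andI (Deriv.iff_refl _).lift (Deriv.iff_refl _).lift))
  | succ k =>
    have e : ((k + 1 : ℕ) : ℤ) - 1 = Int.ofNat k := by simp
    refine hD.neg_deMorgan ⟨fun χ hχ => .inl (.inl hχ), fun χ hχ => ?_⟩ hφ hψ hφ' hψ'
    exact .of_closure_mem (.inr ⟨_, ⟨χ, by rw [e]; exact hχ, rfl⟩, rfl⟩)
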